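/- Let $\Gamma$ be a countable group. A measure preserving action $\boldsymbol{a}=\Gamma\curvearrowright^a(Y,\nu)$ is a Borel action of $\Gamma$ on a standard Borel space $Y$ preserving a Borel probability measure $\nu$; it is non-atomic if $\nu$ has no atoms. For measure preserving actions $\boldsymbol{a}=\Gamma\curvearrowright^a(X,\mu)$ and $\boldsymbol{b}=\Gamma\curvearrowright^b(Y,\nu)$, $\boldsymbol{a}$ is weakly contained in $\boldsymbol{b}$ if for every finite Borel partition $A_0,\dots,A_{k-1}$ of $X$, every finite $F\subseteq\Gamma$ and every $\epsilon>0$ there is a Borel partition $B_0,\dots,B_{k-1}$ of $Y$ with $$|\mu(\gamma^aA_i\cap A_j)-\nu(\gamma^bB_i\cap B_j)|<\epsilon\qquad(\gamma\in F,\ i,j<k);$$ $\boldsymbol{a}$ and $\boldsymbol{b}$ are weakly equivalent if each is weakly contained in the other. Let $\mathrm{Sub}(\Gamma)\subseteq 2^\Gamma$ be the space of subgroups of $\Gamma$, on which $\Gamma$ acts by conjugation. An invariant random subgroup $\theta$ is a conjugation-invariant Borel probability measure on $\mathrm{Sub}(\Gamma)$. The type of $\boldsymbol{a}=\Gamma\curvearrowright^a(Y,\nu)$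 is the invariant random subgroup obtained as the image of $\nu$ under the stabilizer map $y\mapsto\Gamma_y=\{\gamma\in\Gamma:\gamma^ay=y\}$. Let $(Z,\eta)$ be a standard probability space. The $\theta$-random Bernoulli shift $\boldsymbol{s}_{\theta,\eta}$ over $(Z,\eta)$ is the following measure preserving action. Its space is $Z^{\le\backslash\Gamma}=\bigsqcup_{H\in\mathrm{Sub}(\Gamma)}Z^{H\backslash\Gamma}$, where $H\backslash\Gamma$ is the set of right cosets of $H$ and $H_f=H$ for $f\in Z^{H\backslash\Gamma}$, with the Borel structure inherited from $Z^\Gamma\times\mathrm{Sub}(\Gamma)$ via the injection $f\mapsto((\gamma\mapsto f(H_f\gamma)),H_f)$. The action is $(\gamma^sf)(\gamma H_f\gamma^{-1}\delta)=f(H_f\gamma^{-1}\delta)$, with $H_{\gamma^sf}=\gamma H_f\gamma^{-1}$. The measure is $\eta^{\theta\backslash\Gamma}=\int\eta^{H\backslash\Gamma}\,d\theta(H)$, where $\eta^{H\backslash\Gamma}$ is the product measure on $Z^{H\backslash\Gamma}$. The map $f\mapsto H_f$ is a factor map from $\boldsymbol{s}_{\theta,\eta}$ onto the conjugation action $\Gamma\curvearrowright(\mathrm{Sub}(\Gamma),\theta)$,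 and the stabilizer map is a factor map onto it from every action of type $\theta$. If two measure preserving actions, with measures $\mu$ and $\nu$, have a common factor with measure $\theta$, and $\mu=\int\mu_w\,d\theta(w)$ and $\nu=\int\nu_w\,d\theta(w)$ are the corresponding disintegrations, then their relatively independent joining over this factor is the diagonal action on the product space with the measure $\int\mu_w\times\nu_w\,d\theta(w)$. **Theorem.** Let $\theta$ be an invariant random subgroup of $\Gamma$, let $\boldsymbol{a}$ be a non-atomic measure preserving action of $\Gamma$ of type $\theta$, and let $(Z,\eta)$ be any standard probability space. Then the relatively independent joining of $\boldsymbol{s}_{\theta,\eta}$ and $\boldsymbol{a}$ over their common factor $\Gamma\curvearrowright(\mathrm{Sub}(\Gamma),\theta)$, with respect to the factor maps $f\mapsto H_f$ and $y\mapsto\Gamma_y$, is weakly equivalent to $\boldsymbol{a}$. In particular, $\boldsymbol{s}_{\theta,\eta}$ is weakly contained in every non-atomic measure preserving action of type $\theta$. -/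

import Mathlib

open MeasureTheory ProbabilityTheory Set

noncomputable section

namespace MPA

universe u v w z

/-! ### Measure preserving actions -/

/-- A measure preserving action of `Γ`: a Borel action of `Γ` on a standard Borel space, together
with an invariant Borel probability measure. (For a countable discrete group, the action map
`Γ × X → X` is Borel if and only if every group element acts by a Borel map.) -/
structure MPAction (Γ : Type u) [Group Γ] where
  X : Type v
  [meas : MeasurableSpace X]
  [standard : StandardBorelSpace X]
  [act : MulAction Γ X]
  μ : Measure X
  [prob : IsProbabilityMeasure μ]
  measurable_smul : ∀ γ : Γ, Measurable (fun x : X => γ • x)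
  map_smul : ∀ γ : Γ, μ.map (fun x : X => γ • x) = μ

attribute [instance] MPAction.meas MPAction.standard MPAction.act MPAction.prob

/-- `a` is non-atomic, that is, its measure has no atoms. (In a standard Borel space every atom of a
probability measure is, up to a null set, a point of positive measure.) -/
def MPAction.NonAtomic {Γ : Type u} [Group Γ] (a : MPAction.{u, v} Γ) : Prop :=
  ∀ x : a.X, a.μ {x} = 0

/-- `a` is weakly contained in `b`. -/
def WeaklyContained {Γ : Type u} [Group Γ] (a : MPAction.{u, v} Γ) (b : MPAction.{u, w} Γ) : Prop :=
  ∀ (k : ℕ) (A : Fin k → Set a.X),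
    (∀ i, MeasurableSet (A i)) → Pairwise (fun i j => Disjoint (A i) (A j)) → (⋃ i, A i) = univ →
    ∀ (F : Finset Γ) (ε : ℝ), 0 < ε →
      ∃ B : Fin k → Set b.X,
        (∀ i, MeasurableSet (B i)) ∧ Pairwise (fun i j => Disjoint (B i) (B j)) ∧
        (⋃ i, B i) = univ ∧
        ∀ γ ∈ F, ∀ i j,
          |a.μ.real ((fun x => γ • x) '' A i ∩ A j) -
            b.μ.real ((fun y => γ • y) '' B i ∩ B j)| < ε

/-- `a` and `b` are weakly equivalent. -/
def WeaklyEquivalent {Γ : Type u} [Group Γ] (a : MPAction.{u, v} Γ) (b : MPAction.{u, w} Γ) :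
    Prop :=
  WeaklyContained a b ∧ WeaklyContained b a

/-- A factor map from `a` onto `b`: a measurable map that carries the measure of `a` to the measure
of `b` and is equivariant almost everywhere. -/
structure FactorMap {Γ : Type u} [Group Γ] (a : MPAction.{u, v} Γ) (b : MPAction.{u, w} Γ) where
  toFun : a.X → b.X
  measurable : Measurable toFun
  map_eq : a.μ.map toFun = b.μ
  equivariant : ∀ γ : Γ, ∀ᵐ x ∂a.μ, toFun (γ • x) = γ • toFun x

instance {Γ : Type u} [Group Γ] (a : MPAction.{u, v} Γ) : Nonempty a.X :=
  nonempty_of_isProbabilityMeasure a.μ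

/-! ### Relatively independent joinings -/

/-- The disintegration `w ↦ μ_w` of the measure of `a` over the factor `c`, that is, the regular
conditional distribution of the point of `a.X` given its image under the factor map. -/
def FactorMap.disintegration {Γ : Type u} [Group Γ] {a : MPAction.{u, v} Γ} {c : MPAction.{u, w} Γ}
    (p : FactorMap a c) : Kernel c.X a.X :=
  condDistrib id p.toFun a.μ

instance {Γ : Type u} [Group Γ] {a : MPAction.{u, v} Γ} {c : MPAction.{u, w} Γ}
    (p : FactorMap a c) : IsMarkovKernel p.disintegration := by
  unfold FactorMap.disintegration; infer_instance

theorem FactorMap.setLIntegral_disintegration {Γ : Type u} [Group Γ] {a : MPAction.{u, v} Γ}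
    {c : MPAction.{u, w} Γ} (p : FactorMap a c) {C : Set c.X} (hC : MeasurableSet C)
    {A : Set a.X} (hA : MeasurableSet A) :
    ∫⁻ t in C, p.disintegration t A ∂c.μ = a.μ (p.toFun ⁻¹' C ∩ A) := by
  have h := setLIntegral_preimage_condDistrib (μ := a.μ) (X := p.toFun) (Y := id) p.measurable
    aemeasurable_id hA hC
  rw [preimage_id] at h
  rw [← h, ← p.map_eq, setLIntegral_map hC (Kernel.measurable_coe _ hA) p.measurable]
  rfl

theorem MPAction.measurePreserving {Γ : Type u} [Group Γ] (a : MPAction.{u, v} Γ) (γ : Γ) :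
    MeasurePreserving (fun x : a.X => γ • x) a.μ a.μ :=
  ⟨a.measurable_smul γ, a.map_smul γ⟩

/-- The disintegration over a factor is equivariant. -/
theorem FactorMap.disintegration_smul {Γ : Type u} [Group Γ] {a : MPAction.{u, v} Γ}
    {c : MPAction.{u, w} Γ} (p : FactorMap a c) (γ : Γ) {A : Set a.X} (hA : MeasurableSet A) :
    ∀ᵐ t ∂c.μ, p.disintegration t ((fun x => γ • x) ⁻¹' A) = p.disintegration (γ • t) A := by
  have hA' := a.measurable_smul γ hA
  refine ae_eq_of_forall_setLIntegral_eq_of_sigmaFinite (Kernel.measurable_coe _ hA')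
    ((Kernel.measurable_coe _ hA).comp (c.measurable_smul γ)) fun C hC _ => ?_
  have hC' : MeasurableSet ((fun t : c.X => γ⁻¹ • t) ⁻¹' C) := c.measurable_smul γ⁻¹ hC
  have hpre : (fun t : c.X => γ • t) ⁻¹' ((fun t : c.X => γ⁻¹ • t) ⁻¹' C) = C := by
    ext t; simp
  have h1 : ∫⁻ t in C, p.disintegration (γ • t) A ∂c.μ
      = ∫⁻ t in (fun t : c.X => γ⁻¹ • t) ⁻¹' C, p.disintegration t A ∂c.μ := by
    have := (c.measurePreserving γ).setLIntegral_comp_preimage hC' (Kernel.measurable_coe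
      p.disintegration hA)
    rw [hpre] at this
    exact this
  rw [h1, p.setLIntegral_disintegration hC hA', p.setLIntegral_disintegration hC' hA,
    ← (a.measurePreserving γ).measure_preimage
      ((p.measurable hC').inter hA).nullMeasurableSet]
  refine measure_congr ?_
  filter_upwards [p.equivariant γ] with x hx
  apply propext
  change (p.toFun x ∈ C ∧ γ • x ∈ A) ↔ (γ⁻¹ • p.toFun (γ • x) ∈ C ∧ γ • x ∈ A)
  rw [hx, inv_smul_smul]

/-- The relatively independent joining of two measures over a common factor: the integral
`∫ (μ_w × ν_w) dθ(w)` of the products of the fibre measures. -/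
def relIndepMeasure {Γ : Type u} [Group Γ] {a : MPAction.{u, v} Γ} {b : MPAction.{u, w} Γ}
    {c : MPAction.{u, z} Γ} (p : FactorMap a c) (q : FactorMap b c) : Measure (a.X × b.X) :=
  c.μ.bind (fun t => (p.disintegration t).prod (q.disintegration t))

theorem measurable_prod_disintegration {Γ : Type u} [Group Γ] {a : MPAction.{u, v} Γ}
    {b : MPAction.{u, w} Γ} {c : MPAction.{u, z} Γ} (p : FactorMap a c) (q : FactorMap b c) :
    Measurable (fun t => (p.disintegration t).prod (q.disintegration t)) := by
  have h := (p.disintegration ×ₖ q.disintegration).measurable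
  have e : (fun t => (p.disintegration t).prod (q.disintegration t))
      = ⇑(p.disintegration ×ₖ q.disintegration) := by
    funext t; rw [Kernel.prod_apply]
  rw [e]; exact h

theorem relIndepMeasure_prod {Γ : Type u} [Group Γ] {a : MPAction.{u, v} Γ}
    {b : MPAction.{u, w} Γ} {c : MPAction.{u, z} Γ} (p : FactorMap a c) (q : FactorMap b c)
    {A : Set a.X} {B : Set b.X} (hA : MeasurableSet A) (hB : MeasurableSet B) :
    relIndepMeasure p q (A ×ˢ B) = ∫⁻ t, p.disintegration t A * q.disintegration t B ∂c.μ := by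
  rw [relIndepMeasure, Measure.bind_apply (hA.prod hB)
    (measurable_prod_disintegration p q).aemeasurable]
  simp only [Measure.prod_prod]

instance {Γ : Type u} [Group Γ] {a : MPAction.{u, v} Γ}
    {b : MPAction.{u, w} Γ} {c : MPAction.{u, z} Γ} (p : FactorMap a c) (q : FactorMap b c) :
    IsProbabilityMeasure (relIndepMeasure p q) := by
  constructor
  rw [← univ_prod_univ, relIndepMeasure_prod p q .univ .univ]
  simp

theorem relIndepMeasure_map_smul {Γ : Type u} [Group Γ] {a : MPAction.{u, v} Γ}
    {b : MPAction.{u, w} Γ} {c : MPAction.{u, z} Γ} (p : FactorMap a c) (q : FactorMap b c)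
    (γ : Γ) :
    (relIndepMeasure p q).map (fun x => γ • x) = relIndepMeasure p q := by
  have hm : Measurable (fun x : a.X × b.X => γ • x) :=
    ((a.measurable_smul γ).comp measurable_fst).prodMk ((b.measurable_smul γ).comp measurable_snd)
  have : IsProbabilityMeasure ((relIndepMeasure p q).map (fun x : a.X × b.X => γ • x)) :=
    Measure.isProbabilityMeasure_map hm.aemeasurable
  refine Measure.ext_prod fun {A B} hA hB => ?_
  rw [Measure.map_apply hm (hA.prod hB)]
  have e : (fun x : a.X × b.X => γ • x) ⁻¹' (A ×ˢ B)
      = ((fun x : a.X => γ • x) ⁻¹' A) ×ˢ ((fun x : b.X => γ • x) ⁻¹' B) := rfl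
  rw [e, relIndepMeasure_prod p q (a.measurable_smul γ hA) (b.measurable_smul γ hB),
    relIndepMeasure_prod p q hA hB]
  have hf : Measurable (fun t => p.disintegration t A * q.disintegration t B) :=
    (Kernel.measurable_coe p.disintegration hA).mul (Kernel.measurable_coe q.disintegration hB)
  rw [← (c.measurePreserving γ).lintegral_comp hf]
  refine lintegral_congr_ae ?_
  filter_upwards [p.disintegration_smul γ hA, q.disintegration_smul γ hB] with t h1 h2
  rw [h1, h2]

/-- The relatively independent joining of `a` and `b` over the common factor `c`: the diagonal
action of `Γ` on the product, with the relatively independent joining of the two measures. -/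
def relIndepJoining {Γ : Type u} [Group Γ] {a : MPAction.{u, v} Γ} {b : MPAction.{u, w} Γ}
    {c : MPAction.{u, z} Γ} (p : FactorMap a c) (q : FactorMap b c) : MPAction Γ where
  X := a.X × b.X
  μ := relIndepMeasure p q
  measurable_smul γ :=
    ((a.measurable_smul γ).comp measurable_fst).prodMk ((b.measurable_smul γ).comp measurable_snd)
  map_smul := relIndepMeasure_map_smul p q

/-! ### The space of subgroups and invariant random subgroups -/

theorem standardBorel_of_injective {α : Type*} {β : Type*} [MeasurableSpace β]
    [StandardBorelSpace β] (f : α → β) (hf : Function.Injective f)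
    (hr : MeasurableSet (range f)) :
    @StandardBorelSpace α (MeasurableSpace.comap f inferInstance) := by
  let _ := hr.standardBorel
  let _ := upgradeStandardBorel (range f)
  let e : α ≃ range f := Equiv.ofInjective f hf
  let _ : MeasurableSpace α := MeasurableSpace.comap f inferInstance
  let t : TopologicalSpace α := TopologicalSpace.induced e inferInstance
  refine ⟨⟨t, ⟨?_⟩, e.polishSpace_induced⟩⟩
  have h : borel α = (borel (range f)).comap e := borel_comap (f := e) (t := inferInstance)
  rw [h, ← (inferInstance : BorelSpace (range f)).measurable_eq]
  change MeasurableSpace.comap f _ = MeasurableSpace.comap e (MeasurableSpace.comap _ _)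
  rw [MeasurableSpace.comap_comp]
  rfl

/-- The Borel structure of `Sub(Γ)` as a subspace of `2^Γ`. For countable `Γ` the product
σ-algebra on `2^Γ` is the Borel σ-algebra of the product topology. -/
instance subgroupMeasurableSpace (Γ : Type u) [Group Γ] : MeasurableSpace (Subgroup Γ) :=
  MeasurableSpace.comap (fun H : Subgroup Γ => (H : Set Γ)) inferInstance

theorem measurableSet_mem {Γ : Type u} [Group Γ] (γ : Γ) :
    MeasurableSet {H : Subgroup Γ | γ ∈ H} :=
  ⟨{S : Set Γ | γ ∈ S}, measurableSet_setOfPred.2 (measurable_set_mem γ), rfl⟩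

theorem measurable_to_subgroup {Γ : Type u} [Group Γ] {α : Type*} [MeasurableSpace α]
    {f : α → Subgroup Γ} (h : ∀ γ, MeasurableSet {x | γ ∈ f x}) : Measurable f :=
  measurable_comap_iff.2 (measurable_set_iff.2 fun γ => measurableSet_setOfPred.1 (h γ))

instance {Γ : Type u} [Group Γ] [Countable Γ] : StandardBorelSpace (Subgroup Γ) := by
  have : StandardBorelSpace (Set Γ) := inferInstanceAs (StandardBorelSpace (Γ → Prop))
  refine standardBorel_of_injective _ SetLike.coe_injective ?_
  have hm : ∀ γ : Γ, MeasurableSet {S : Set Γ | γ ∈ S} := fun γ =>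
    measurableSet_setOfPred.2 (measurable_set_mem γ)
  have e : range (fun H : Subgroup Γ => (H : Set Γ))
      = {S : Set Γ | 1 ∈ S} ∩ (⋂ x : Γ, ⋂ y : Γ, ({S : Set Γ | x ∈ S}ᶜ ∪
        ({S : Set Γ | y ∈ S}ᶜ ∪ {S : Set Γ | x * y ∈ S}))) ∩
        (⋂ x : Γ, ({S : Set Γ | x ∈ S}ᶜ ∪ {S : Set Γ | x⁻¹ ∈ S})) := by
    ext S
    simp only [mem_range, mem_inter_iff, mem_iInter, mem_union, mem_compl_iff, mem_ofPred_eq]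
    constructor
    · rintro ⟨H, rfl⟩
      refine ⟨⟨H.one_mem, fun x y => ?_⟩, fun x => ?_⟩
      · by_cases hx : x ∈ H
        · by_cases hy : y ∈ H
          · exact Or.inr (Or.inr (H.mul_mem hx hy))
          · exact Or.inr (Or.inl hy)
        · exact Or.inl hx
      · by_cases hx : x ∈ H
        · exact Or.inr (H.inv_mem hx)
        · exact Or.inl hx
    · rintro ⟨⟨h1, h2⟩, h3⟩
      refine ⟨{ carrier := S, one_mem' := h1, mul_mem' := ?_, inv_mem' := ?_ }, rfl⟩
      · intro x y hx hy
        exact ((h2 x y).resolve_left (not_not.2 hx)).resolve_left (not_not.2 hy)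
      · intro x hx
        exact (h3 x).resolve_left (not_not.2 hx)
  rw [e]
  exact ((hm 1).inter (MeasurableSet.iInter fun x => MeasurableSet.iInter fun y =>
    (hm x).compl.union ((hm y).compl.union (hm _)))).inter
    (MeasurableSet.iInter fun x => (hm x).compl.union (hm _))

/-- The conjugate subgroup `γ H γ⁻¹`. -/
def conj {Γ : Type u} [Group Γ] (γ : Γ) (H : Subgroup Γ) : Subgroup Γ :=
  H.map (MulAut.conj γ).toMonoidHom

theorem mem_conj {Γ : Type u} [Group Γ] {γ x : Γ} {H : Subgroup Γ} :
    x ∈ conj γ H ↔ γ⁻¹ * x * γ ∈ H := by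
  constructor
  · rintro ⟨y, hy, rfl⟩
    simpa [mul_assoc] using hy
  · intro h
    exact ⟨_, h, by simp [mul_assoc]⟩

/-- `Γ` acts on the space of its subgroups by conjugation. -/
abbrev conjAction (Γ : Type u) [Group Γ] : MulAction Γ (Subgroup Γ) where
  smul := conj
  one_smul H := by
    ext x
    exact mem_conj.trans (by simp)
  mul_smul γ δ H := by
    ext x
    refine mem_conj.trans ?_
    refine Iff.trans ?_ (mem_conj (H := conj δ H)).symm
    rw [mem_conj]
    simp [mul_assoc]

theorem measurable_conj {Γ : Type u} [Group Γ] (γ : Γ) :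
    Measurable (conj γ : Subgroup Γ → Subgroup Γ) :=
  measurable_to_subgroup fun x => by
    simp only [mem_conj]
    exact measurableSet_mem _

/-- Invariant random subgroups: conjugation invariant Borel probability measures on `Sub(Γ)`. -/
structure IRS (Γ : Type u) [Group Γ] where
  measure : Measure (Subgroup Γ)
  [prob : IsProbabilityMeasure measure]
  map_conj : ∀ γ : Γ, measure.map (conj γ) = measure

attribute [instance] IRS.prob

/-- The measure preserving action of `Γ` by conjugation on `(Sub(Γ), θ)`. -/
def IRS.action {Γ : Type u} [Group Γ] [Countable Γ] (θ : IRS Γ) : MPAction.{u, u} Γ where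
  X := Subgroup Γ
  act := conjAction Γ
  μ := θ.measure
  measurable_smul := measurable_conj
  map_smul := θ.map_conj

/-! ### The type of an action -/

theorem measurable_stabilizer {Γ : Type u} [Group Γ] (a : MPAction.{u, v} Γ) :
    Measurable (fun x : a.X => MulAction.stabilizer Γ x) :=
  measurable_to_subgroup fun γ => by
    simp only [MulAction.mem_stabilizer_iff]
    exact measurableSet_eq_fun (a.measurable_smul γ) measurable_id

theorem stabilizer_smul_eq {Γ : Type u} [Group Γ] (a : MPAction.{u, v} Γ) (γ : Γ) (x : a.X) :
    MulAction.stabilizer Γ (γ • x) = conj γ (MulAction.stabilizer Γ x) := by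
  ext δ
  rw [mem_conj, MulAction.mem_stabilizer_iff, MulAction.mem_stabilizer_iff, mul_smul, mul_smul,
    inv_smul_eq_iff]

/-- The type of `a`: the image of its measure under the stabilizer map. -/
def MPAction.type {Γ : Type u} [Group Γ] (a : MPAction.{u, v} Γ) : IRS Γ where
  measure := a.μ.map (fun x => MulAction.stabilizer Γ x)
  prob := Measure.isProbabilityMeasure_map (measurable_stabilizer a).aemeasurable
  map_conj γ := by
    rw [Measure.map_map (measurable_conj γ) (measurable_stabilizer a)]
    have e : conj γ ∘ (fun x : a.X => MulAction.stabilizer Γ x)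
        = (fun x : a.X => MulAction.stabilizer Γ x) ∘ (fun x : a.X => γ • x) := by
      funext x
      exact (stabilizer_smul_eq a γ x).symm
    rw [e, ← Measure.map_map (measurable_stabilizer a) (a.measurable_smul γ), a.map_smul]

/-- The stabilizer map as a factor map from an action of type `θ` onto `Γ ↷ (Sub(Γ), θ)`. -/
def stabilizerFactor {Γ : Type u} [Group Γ] [Countable Γ] (a : MPAction.{u, v} Γ) {θ : IRS Γ}
    (h : a.type = θ) : FactorMap a θ.action where
  toFun x := MulAction.stabilizer Γ x
  measurable := measurable_stabilizer a
  map_eq := by subst h; rfl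
  equivariant γ := Filter.Eventually.of_forall fun x => stabilizer_smul_eq a γ x

/-! ### Random Bernoulli shifts -/

/-- The right cosets `Hγ` of a subgroup. -/
abbrev RightCosets {Γ : Type u} [Group Γ] (H : Subgroup Γ) : Type u :=
  Quotient (QuotientGroup.rightRel H)

/-- The right coset `Hγ`. -/
def rightCoset {Γ : Type u} [Group Γ] (H : Subgroup Γ) (γ : Γ) : RightCosets H :=
  Quotient.mk (QuotientGroup.rightRel H) γ

theorem rightCoset_eq {Γ : Type u} [Group Γ] {H : Subgroup Γ} {γ δ : Γ} :
    rightCoset H γ = rightCoset H δ ↔ δ * γ⁻¹ ∈ H :=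
  Quotient.eq.trans QuotientGroup.rightRel_apply

/-- The disjoint union over all subgroups `H` of the spaces of functions from `H \ Γ` to `Z`. -/
structure ShiftSpace (Γ : Type u) [Group Γ] (Z : Type w) where
  subgroup : Subgroup Γ
  toFun : RightCosets subgroup → Z

namespace ShiftSpace

/-- The injection `f ↦ ((γ ↦ f (H_f γ)), H_f)` into `Z^Γ × Sub(Γ)`. -/
def embed {Γ : Type u} [Group Γ] {Z : Type w} (f : ShiftSpace Γ Z) : (Γ → Z) × Subgroup Γ :=
  (fun γ => f.2 (rightCoset f.1 γ), f.1)

/-- The Borel structure inherited from `Z^Γ × Sub(Γ)`. -/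
instance {Γ : Type u} [Group Γ] {Z : Type w} [MeasurableSpace Z] :
    MeasurableSpace (ShiftSpace Γ Z) :=
  MeasurableSpace.comap embed inferInstance

theorem embed_injective {Γ : Type u} [Group Γ] {Z : Type w} :
    Function.Injective (embed : ShiftSpace Γ Z → (Γ → Z) × Subgroup Γ) := by
  rintro ⟨H, f⟩ ⟨K, g⟩ h
  obtain rfl : H = K := congrArg Prod.snd h
  have h1 : ∀ γ, f (rightCoset H γ) = g (rightCoset H γ) := congrFun (congrArg Prod.fst h)
  have h2 : f = g := by
    funext c
    induction c using Quotient.inductionOn with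
    | h γ => exact h1 γ
  rw [h2]

theorem range_embed {Γ : Type u} [Group Γ] {Z : Type w} :
    range (embed : ShiftSpace Γ Z → (Γ → Z) × Subgroup Γ)
      = {p | ∀ γ δ : Γ, δ ∈ p.2 → p.1 (δ * γ) = p.1 γ} := by
  ext ⟨g, H⟩
  constructor
  · rintro ⟨⟨K, f⟩, h⟩
    obtain rfl : K = H := congrArg Prod.snd h
    have h1 : ∀ γ, f (rightCoset K γ) = g γ := congrFun (congrArg Prod.fst h)
    intro γ δ hδ
    change g (δ * γ) = g γ
    rw [← h1, ← h1]
    congr 1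
    refine rightCoset_eq.2 ?_
    simpa using hδ
  · intro h
    refine ⟨⟨H, fun c => Quotient.lift g (fun x y hxy => ?_) c⟩, rfl⟩
    have := h x (y * x⁻¹) (QuotientGroup.rightRel_apply.1 hxy)
    simpa using this.symm

instance {Γ : Type u} [Group Γ] [Countable Γ] {Z : Type w} [MeasurableSpace Z]
    [StandardBorelSpace Z] : StandardBorelSpace (ShiftSpace Γ Z) := by
  refine standardBorel_of_injective _ embed_injective ?_
  rw [range_embed]
  simp only [ofPred_forall]
  refine MeasurableSet.iInter fun γ => MeasurableSet.iInter fun δ => ?_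
  have e : {p : (Γ → Z) × Subgroup Γ | δ ∈ p.2 → p.1 (δ * γ) = p.1 γ}
      = {p | δ ∈ p.2}ᶜ ∪ {p | p.1 (δ * γ) = p.1 γ} := by
    ext p; simp [imp_iff_not_or]
  rw [e]
  exact (measurable_snd (measurableSet_mem δ)).compl.union
    (measurableSet_eq_fun ((measurable_pi_apply _).comp measurable_fst)
      ((measurable_pi_apply _).comp measurable_fst))

/-- The bijection `γHγ⁻¹ \ Γ → H \ Γ`, `γHγ⁻¹δ ↦ Hγ⁻¹δ`. -/
def cosetEquiv {Γ : Type u} [Group Γ] (γ : Γ) (H : Subgroup Γ) :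
    RightCosets (conj γ H) ≃ RightCosets H :=
  Quotient.congr (Equiv.mulLeft γ⁻¹) fun x y => by
    change QuotientGroup.rightRel (conj γ H) x y ↔ QuotientGroup.rightRel H (γ⁻¹ * x) (γ⁻¹ * y)
    rw [QuotientGroup.rightRel_apply, QuotientGroup.rightRel_apply, mem_conj]
    simp [mul_assoc]

/-- The shift action: `γ • f` is the function on `γHγ⁻¹ \ Γ` (with `H = H_f`) given by
`(γ • f) (γHγ⁻¹δ) = f (Hγ⁻¹δ)`. -/
instance {Γ : Type u} [Group Γ] {Z : Type w} : SMul Γ (ShiftSpace Γ Z) where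
  smul γ f := ⟨conj γ f.1, f.2 ∘ cosetEquiv γ f.1⟩

theorem embed_smul {Γ : Type u} [Group Γ] {Z : Type w} (γ : Γ) (f : ShiftSpace Γ Z) :
    embed (γ • f) = ((fun δ => (embed f).1 (γ⁻¹ * δ)), conj γ (embed f).2) :=
  rfl

instance {Γ : Type u} [Group Γ] {Z : Type w} : MulAction Γ (ShiftSpace Γ Z) where
  one_smul f := by
    apply embed_injective
    rw [embed_smul]
    refine Prod.ext (funext fun δ => by simp) ?_
    exact (conjAction Γ).one_smul f.1
  mul_smul γ δ f := by
    apply embed_injective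
    rw [embed_smul, embed_smul, embed_smul]
    refine Prod.ext (funext fun x => by simp [mul_assoc]) ?_
    exact (conjAction Γ).mul_smul γ δ f.1

theorem measurable_smul {Γ : Type u} [Group Γ] {Z : Type w} [MeasurableSpace Z] (γ : Γ) :
    Measurable (fun f : ShiftSpace Γ Z => γ • f) := by
  refine measurable_comap_iff.2 ?_
  have hE : Measurable (embed : ShiftSpace Γ Z → (Γ → Z) × Subgroup Γ) := comap_measurable _
  change Measurable (fun f : ShiftSpace Γ Z =>
    (((fun δ => (embed f).1 (γ⁻¹ * δ)), conj γ (embed f).2) : (Γ → Z) × Subgroup Γ))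
  exact (measurable_pi_lambda _ fun δ => (measurable_pi_apply _).comp hE.fst).prodMk
    ((measurable_conj γ).comp hE.snd)

/-- The projection `f ↦ H_f`. -/
def proj {Γ : Type u} [Group Γ] {Z : Type w} (f : ShiftSpace Γ Z) : Subgroup Γ := f.1

theorem measurable_proj {Γ : Type u} [Group Γ] {Z : Type w} [MeasurableSpace Z] :
    Measurable (proj : ShiftSpace Γ Z → Subgroup Γ) := by
  have hE : Measurable (embed : ShiftSpace Γ Z → (Γ → Z) × Subgroup Γ) := comap_measurable _
  exact hE.snd

theorem measurable_mk {Γ : Type u} [Group Γ] {Z : Type w} [MeasurableSpace Z] (H : Subgroup Γ) :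
    Measurable (fun f : RightCosets H → Z => (⟨H, f⟩ : ShiftSpace Γ Z)) := by
  refine measurable_comap_iff.2 ?_
  change Measurable (fun f : RightCosets H → Z =>
    (((fun γ => f (rightCoset H γ)), H) : (Γ → Z) × Subgroup Γ))
  exact (measurable_pi_lambda _ fun δ => measurable_pi_apply _).prodMk measurable_const

end ShiftSpace

/-- The product measure `η^(H \ Γ)`, as a measure on `ShiftSpace Γ Z` that lives on the functions
from `H \ Γ` to `Z`. -/
def cosetProductMeasure {Γ : Type u} [Group Γ] {Z : Type w} [MeasurableSpace Z] (η : Measure Z)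
    [IsProbabilityMeasure η] (H : Subgroup Γ) : Measure (ShiftSpace Γ Z) :=
  (Measure.infinitePi (fun _ : RightCosets H => η)).map
    (fun f => (⟨H, f⟩ : ShiftSpace Γ Z))

/-- The measure `∫ η^(H \ Γ) dθ(H)`. -/
def shiftMeasure {Γ : Type u} [Group Γ] {Z : Type w} [MeasurableSpace Z] (θ : IRS Γ)
    (η : Measure Z) [IsProbabilityMeasure η] : Measure (ShiftSpace Γ Z) :=
  θ.measure.bind (cosetProductMeasure η)

theorem measurable_reindex {ι κ : Type*} (Z : Type w) [MeasurableSpace Z] (g : ι → κ) :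
    Measurable (fun (f : κ → Z) (i : ι) => f (g i)) :=
  measurable_pi_lambda _ fun i => measurable_pi_apply (g i)

/-- Product measures are compatible with restriction along an injection of the index sets. -/
theorem infinitePi_map_comp {ι κ : Type*} {Z : Type w} [MeasurableSpace Z] (η : Measure Z)
    [IsProbabilityMeasure η] {g : ι → κ} (hg : Function.Injective g) :
    (Measure.infinitePi (fun _ : κ => η)).map (fun f i => f (g i))
      = Measure.infinitePi (fun _ : ι => η) := by
  classical
  refine Measure.eq_infinitePi _ fun s t ht => ?_
  have hm := measurable_reindex Z g
  rw [Measure.map_apply hm (MeasurableSet.pi s.countable_toSet fun i _ => ht i)]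
  rcases isEmpty_or_nonempty ι with hι | hι
  · have hs : s = ∅ := Finset.eq_empty_of_isEmpty s
    subst hs
    simp
  have e : (fun (f : κ → Z) (i : ι) => f (g i)) ⁻¹' (Set.pi s t)
      = Set.pi (s.image g : Finset κ) (fun j => t (Function.invFun g j)) := by
    ext f
    simp [Set.mem_pi, Function.leftInverse_invFun hg _]
  rw [e, Measure.infinitePi_pi _ fun i _ => ht _, Finset.prod_image fun x _ y _ h => hg h]
  simp [Function.leftInverse_invFun hg _]

theorem map_smul_cosetProductMeasure {Γ : Type u} [Group Γ] {Z : Type w} [MeasurableSpace Z]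
    (η : Measure Z) [IsProbabilityMeasure η] (γ : Γ) (H : Subgroup Γ) :
    (cosetProductMeasure η H).map (fun f => γ • f) = cosetProductMeasure η (conj γ H) := by
  rw [cosetProductMeasure, cosetProductMeasure,
    ← infinitePi_map_comp η (ShiftSpace.cosetEquiv γ H).injective,
    Measure.map_map (ShiftSpace.measurable_smul γ) (ShiftSpace.measurable_mk H),
    Measure.map_map (ShiftSpace.measurable_mk _) (measurable_reindex Z _)]
  rfl

/-- The measures `η^(H \ Γ)` depend measurably on `H`. -/
theorem measurable_cosetProductMeasure {Γ : Type u} [Group Γ] [Countable Γ] {Z : Type w}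
    [MeasurableSpace Z] (η : Measure Z) [IsProbabilityMeasure η] :
    Measurable (cosetProductMeasure (Γ := Γ) η) := by
  classical
  let _ : MeasurableSpace Γ := ⊤
  have : DiscreteMeasurableSpace Γ := ⟨fun _ => trivial⟩
  have : Nonempty Γ := ⟨1⟩
  obtain ⟨enum, henum⟩ := exists_surjective_nat Γ
  have hex : ∀ (γ : Γ) (H : Subgroup Γ), ∃ n, enum n * γ⁻¹ ∈ H := fun γ H => by
    obtain ⟨n, hn⟩ := henum γ
    exact ⟨n, by rw [hn, mul_inv_cancel]; exact H.one_mem⟩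
  let rep : Subgroup Γ → Γ → Γ := fun H γ => enum (Nat.find (hex γ H))
  have hrep : ∀ H γ, rightCoset H (rep H γ) = rightCoset H γ := fun H γ =>
    (rightCoset_eq.2 (Nat.find_spec (hex γ H))).symm
  have hrep' : ∀ H γ δ, rightCoset H γ = rightCoset H δ → rep H γ = rep H δ := by
    intro H γ δ h
    have hp : ∀ n, enum n * γ⁻¹ ∈ H ↔ enum n * δ⁻¹ ∈ H := fun n => by
      rw [← rightCoset_eq, ← rightCoset_eq, h]
    simp only [rep]
    congr 1
    exact Nat.find_congr' (fun {n} => hp n)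
  have hrepm : ∀ γ, Measurable (fun H => rep H γ) := fun γ =>
    (measurable_of_countable enum).comp
      (measurable_find (p := fun H n => enum n * γ⁻¹ ∈ H) (hex γ) fun n => measurableSet_mem _)
  let sec : (H : Subgroup Γ) → RightCosets H → Γ := fun H =>
    Quotient.lift (rep H) fun x y h => hrep' H x y (Quotient.sound h)
  have hsec : ∀ H, Function.Injective (sec H) := by
    intro H c d h
    induction c using Quotient.inductionOn with
    | h x =>
      induction d using Quotient.inductionOn with
      | h y =>
        have h' : rep H x = rep H y := h
        change rightCoset H x = rightCoset H y
        rw [← hrep H x, h', hrep]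
  let T : Subgroup Γ × (Γ → Z) → ShiftSpace Γ Z := fun p => ⟨p.1, fun c => p.2 (sec p.1 c)⟩
  have hT : Measurable T := by
    refine measurable_comap_iff.2 ?_
    change Measurable (fun p : Subgroup Γ × (Γ → Z) =>
      (((fun γ => p.2 (rep p.1 γ)), p.1) : (Γ → Z) × Subgroup Γ))
    refine (measurable_pi_lambda _ fun γ => ?_).prodMk measurable_fst
    have hev : Measurable (fun q : (Γ → Z) × Γ => q.1 q.2) :=
      measurable_from_prod_countable_left fun δ => measurable_pi_apply δ
    exact hev.comp (measurable_snd.prodMk ((hrepm γ).comp measurable_fst))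
  refine Measure.measurable_of_measurable_coe _ fun s hs => ?_
  have e : ∀ H, cosetProductMeasure η H s
      = Measure.infinitePi (fun _ : Γ => η) (Prod.mk H ⁻¹' (T ⁻¹' s)) := by
    intro H
    rw [cosetProductMeasure, ← infinitePi_map_comp η (hsec H),
      Measure.map_map (ShiftSpace.measurable_mk H) (measurable_reindex Z _),
      Measure.map_apply ((ShiftSpace.measurable_mk H).comp (measurable_reindex Z _)) hs]
    rfl
  simp only [e]
  exact measurable_measure_prodMk_left (hT hs)

instance {Γ : Type u} [Group Γ] {Z : Type w} [MeasurableSpace Z] (η : Measure Z)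
    [IsProbabilityMeasure η] (H : Subgroup Γ) : IsProbabilityMeasure (cosetProductMeasure η H) :=
  Measure.isProbabilityMeasure_map (ShiftSpace.measurable_mk H).aemeasurable

theorem shiftMeasure_apply {Γ : Type u} [Group Γ] [Countable Γ] {Z : Type w} [MeasurableSpace Z]
    (θ : IRS Γ) (η : Measure Z) [IsProbabilityMeasure η] {s : Set (ShiftSpace Γ Z)}
    (hs : MeasurableSet s) :
    shiftMeasure θ η s = ∫⁻ H, cosetProductMeasure η H s ∂θ.measure :=
  Measure.bind_apply hs (measurable_cosetProductMeasure η).aemeasurable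

instance {Γ : Type u} [Group Γ] [Countable Γ] {Z : Type w} [MeasurableSpace Z] (θ : IRS Γ)
    (η : Measure Z) [IsProbabilityMeasure η] : IsProbabilityMeasure (shiftMeasure θ η) := by
  constructor
  rw [shiftMeasure_apply θ η .univ]
  simp

/-- The `θ`-random Bernoulli shift of `Γ` over `(Z, η)`. -/
def randomBernoulliShift {Γ : Type u} [Group Γ] [Countable Γ] {Z : Type w} [MeasurableSpace Z]
    [StandardBorelSpace Z] (θ : IRS Γ) (η : Measure Z) [IsProbabilityMeasure η] : MPAction Γ where
  X := ShiftSpace Γ Z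
  μ := shiftMeasure θ η
  measurable_smul := ShiftSpace.measurable_smul
  map_smul γ := by
    ext s hs
    have hs' := ShiftSpace.measurable_smul γ hs
    rw [Measure.map_apply (ShiftSpace.measurable_smul γ) hs, shiftMeasure_apply θ η hs',
      shiftMeasure_apply θ η hs]
    conv_rhs => rw [← θ.map_conj γ]
    have hf : Measurable (fun H : Subgroup Γ => cosetProductMeasure η H s) :=
      (Measure.measurable_coe hs).comp (measurable_cosetProductMeasure η)
    rw [lintegral_map hf (measurable_conj γ)]
    refine lintegral_congr fun H => ?_
    rw [← map_smul_cosetProductMeasure, Measure.map_apply (ShiftSpace.measurable_smul γ) hs]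

/-- The projection `f ↦ H_f` as a factor map from the random Bernoulli shift onto
`Γ ↷ (Sub(Γ), θ)`. -/
def shiftFactor {Γ : Type u} [Group Γ] [Countable Γ] {Z : Type w} [MeasurableSpace Z]
    [StandardBorelSpace Z] (θ : IRS Γ) (η : Measure Z) [IsProbabilityMeasure η] :
    FactorMap (randomBernoulliShift θ η) θ.action where
  toFun := ShiftSpace.proj
  measurable := ShiftSpace.measurable_proj
  map_eq := by
    change (shiftMeasure θ η).map ShiftSpace.proj = θ.measure
    ext s hs
    rw [Measure.map_apply ShiftSpace.measurable_proj hs,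
      shiftMeasure_apply θ η (ShiftSpace.measurable_proj hs)]
    have e : ∀ H : Subgroup Γ, cosetProductMeasure η H (ShiftSpace.proj ⁻¹' s)
        = s.indicator 1 H := by
      intro H
      rw [cosetProductMeasure, Measure.map_apply (ShiftSpace.measurable_mk H)
        (ShiftSpace.measurable_proj hs)]
      by_cases h : H ∈ s
      · have : (fun f => (⟨H, f⟩ : ShiftSpace Γ Z)) ⁻¹' (ShiftSpace.proj ⁻¹' s) = univ :=
          eq_univ_of_forall fun f => h
        rw [this, measure_univ, indicator_of_mem h, Pi.one_apply]
      · have : (fun f => (⟨H, f⟩ : ShiftSpace Γ Z)) ⁻¹' (ShiftSpace.proj ⁻¹' s) = ∅ :=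
          eq_empty_of_forall_notMem fun f hf => h hf
        rw [this, measure_empty, indicator_of_notMem h]
    simp only [e]
    exact lintegral_indicator_one hs
  equivariant γ := Filter.Eventually.of_forall fun f => rfl

end MPA

end

open MPA MeasureTheory

open Filter Topology

/-! The joining projects equivariantly and measure preservingly onto `a` and onto the shift, so it
weakly contains both (`weaklyContained_of_measurePreserving`). By transitivity everything reduces to
`weaklyContained_relIndepJoining`: the joining is weakly contained in `a`.

A measurable labelling φ : Y → Z of the space of `a` gives an equivariant map `labelMap φ` into the
space of the joining: y goes to the pair of y and the configuration Γ_y γ ↦ φ(γ⁻¹y). By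
`weaklyContained_of_setAlgebra` it is enough to choose φ so that the image of ν is close to the
measure of the joining on finitely many events, each depending on finitely many labels, the subgroup
and y.

Such a φ is found at random (`exists_labelling`). Cut Y into countably many pieces, finer and finer
with n, and give the pieces independent labels of law η. For fixed y and large n, the distinct
points among the finitely many γ⁻¹y lie in distinct pieces. Since γ⁻¹y = δ⁻¹y exactly when Γ_y γ =
Γ_y δ, their labels then have the same law as in the joining, where y is drawn first and the cosets
of Γ_y are labelled independently (`relIndepMeasure_shiftFactor_stabilizerFactor`). So the expected
measures of the events converge to the right values. As ν has no atoms, almost every pair x, y has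
disjoint orbits. The labels seen from x and from y are then eventually independent, so the second
moments converge to the squares, and Chebyshev's inequality yields one labelling that suits all the
events. -/

namespace MPA

universe u v w z

/-! ### Joint laws of independent labels -/

section Reindex

variable {ι κ κ' Z : Type*} [MeasurableSpace Z]

/-- The joint law of the labels at the places `u i`, when the points of `κ` carry independent labels
of law `η`. -/
noncomputable def reindexLaw (η : Measure Z) [IsProbabilityMeasure η] (u : ι → κ) :
    Measure (ι → Z) :=
  (Measure.infinitePi (fun _ : κ => η)).map (fun f i => f (u i))

instance (η : Measure Z) [IsProbabilityMeasure η] (u : ι → κ) :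
    IsProbabilityMeasure (reindexLaw η u) :=
  Measure.isProbabilityMeasure_map (measurable_reindex Z u).aemeasurable

/-- Restricting independent labels along an injection leaves independent labels
(`infinitePi_map_comp`), so renaming the places injectively does not matter. -/
theorem reindexLaw_comp_injective (η : Measure Z) [IsProbabilityMeasure η] (u : ι → κ)
    {g : κ → κ'} (hg : Function.Injective g) : reindexLaw η (g ∘ u) = reindexLaw η u := by
  rw [reindexLaw, reindexLaw, ← infinitePi_map_comp η hg,
    Measure.map_map (measurable_reindex Z u) (measurable_reindex Z g)]
  rfl

/-- The joint law of the labels depends only on which of the places coincide. -/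
theorem reindexLaw_congr (η : Measure Z) [IsProbabilityMeasure η] {u : ι → κ} {v : ι → κ'}
    (h : ∀ i j, u i = u j ↔ v i = v j) : reindexLaw η u = reindexLaw η v := by
  -- `w` renames the places hit by `u` as those hit by `v`. One direction of `h` makes it compatible
  -- with the choice of preimages, the other makes it injective. Both laws then agree with that of
  -- `u` regarded as a map onto its range.
  let w : range u → κ' := fun x => v x.2.choose
  have hw : w ∘ rangeFactorization u = v := by
    funext i
    exact (h _ _).1 (rangeFactorization u i).2.choose_spec
  have hinj : Function.Injective w := by
    intro x y hxy
    apply Subtype.ext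
    rw [← x.2.choose_spec, ← y.2.choose_spec]
    exact (h _ _).2 hxy
  rw [← hw, reindexLaw_comp_injective η _ hinj,
    ← reindexLaw_comp_injective η (rangeFactorization u) Subtype.val_injective]
  rfl

/-- Labels at two disjoint finite families of places are independent. -/
theorem indepFun_reindex {ι' : Type*} [Finite ι] [Finite ι'] (η : Measure Z)
    [IsProbabilityMeasure η] {u : ι → κ} {v : ι' → κ} (h : ∀ i j, u i ≠ v j) :
    IndepFun (fun (f : κ → Z) i => f (u i)) (fun (f : κ → Z) j => f (v j))
      (Measure.infinitePi (fun _ : κ => η)) := by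
  classical
  have := Fintype.ofFinite ι
  have := Fintype.ofFinite ι'
  have hi : iIndepFun (fun (x : κ) (f : κ → Z) => f x) (Measure.infinitePi (fun _ : κ => η)) :=
    iIndepFun_infinitePi (X := fun _ z => z) fun _ => measurable_id
  -- Places may repeat within `u` or within `v`, so independence is taken between the two sets of
  -- places, and the tuples are read off from these.
  have hd : Disjoint (Finset.univ.image u) (Finset.univ.image v) := by
    rw [Finset.disjoint_left]
    intro x hx hy
    obtain ⟨i, -, rfl⟩ := Finset.mem_image.1 hx
    obtain ⟨j, -, hj⟩ := Finset.mem_image.1 hy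
    exact h i j hj.symm
  have := hi.indepFun_finset _ _ hd fun x => measurable_pi_apply x
  exact this.comp
    (measurable_reindex Z fun i => (⟨u i, Finset.mem_image_of_mem u (Finset.mem_univ i)⟩ :
      {x // x ∈ Finset.univ.image u}))
    (measurable_reindex Z fun i => (⟨v i, Finset.mem_image_of_mem v (Finset.mem_univ i)⟩ :
      {x // x ∈ Finset.univ.image v}))

end Reindex

/-! ### The second moment method for random sets -/

/-- Chebyshev: finitely many sequences of random variables whose first two moments converge to those
of constants are simultaneously close to these constants at some point. -/
theorem exists_forall_abs_sub_lt_of_tendsto_moments {Ω ι : Type*} [MeasurableSpace Ω]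
    {P : Measure Ω} [IsProbabilityMeasure P] [Fintype ι] (X : ι → ℕ → Ω → ℝ) (q : ι → ℝ)
    (hX : ∀ m n, MemLp (X m n) 2 P)
    (h1 : ∀ m, Tendsto (fun n => ∫ z, X m n z ∂P) atTop (𝓝 (q m)))
    (h2 : ∀ m, Tendsto (fun n => ∫ z, X m n z ^ 2 ∂P) atTop (𝓝 (q m ^ 2)))
    {ε : ℝ} (hε : 0 < ε) : ∃ n z, ∀ m, |X m n z - q m| < ε := by
  have hint : ∀ m n, Integrable (fun z => (X m n z - q m) ^ 2) P := fun m n =>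
    ((hX m n).sub (memLp_const (q m))).integrable_sq
  have hexp : ∀ m n, ∫ z, (X m n z - q m) ^ 2 ∂P
      = ∫ z, X m n z ^ 2 ∂P - 2 * q m * ∫ z, X m n z ∂P + q m ^ 2 := by
    intro m n
    have i1 : Integrable (fun z => X m n z ^ 2) P := (hX m n).integrable_sq
    have i2 : Integrable (fun z => 2 * q m * X m n z) P :=
      ((hX m n).integrable one_le_two).const_mul _
    have e : (fun z => (X m n z - q m) ^ 2)
        = fun z => X m n z ^ 2 - 2 * q m * X m n z + q m ^ 2 := by
      funext z; ring
    have i3 : Integrable (fun z => X m n z ^ 2 - 2 * q m * X m n z) P := i1.sub i2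
    rw [e, integral_add i3 (integrable_const _), integral_sub i1 i2, integral_const_mul]
    simp
  -- Summing the squared deviations over `m` lets a single `n` and a single point `z` serve all `m`.
  have hsum : Tendsto (fun n => ∫ z, ∑ m, (X m n z - q m) ^ 2 ∂P) atTop (𝓝 0) := by
    have e : ∀ n, ∫ z, ∑ m, (X m n z - q m) ^ 2 ∂P
        = ∑ m, (∫ z, X m n z ^ 2 ∂P - 2 * q m * ∫ z, X m n z ∂P + q m ^ 2) := by
      intro n
      rw [integral_finsetSum _ fun m _ => hint m n]
      exact Finset.sum_congr rfl fun m _ => hexp m n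
    simp only [e]
    have : (0 : ℝ) = ∑ m, (q m ^ 2 - 2 * q m * q m + q m ^ 2) := by
      rw [Finset.sum_eq_zero fun m _ => by ring]
    rw [this]
    exact tendsto_finsetSum _ fun m _ => ((h2 m).sub ((h1 m).const_mul _)).add_const _
  obtain ⟨n, hn⟩ := (hsum.eventually_lt_const (pow_pos hε 2)).exists
  obtain ⟨z, hz⟩ := exists_le_integral (integrable_finsetSum _ fun m _ => hint m n) (μ := P)
  refine ⟨n, z, fun m => abs_lt_of_sq_lt_sq ?_ hε.le⟩
  have hz' := hz.trans_lt hn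
  exact (Finset.single_le_sum (f := fun m => (X m n z - q m) ^ 2) (fun _ _ => sq_nonneg _)
    (Finset.mem_univ m)).trans_lt hz'

theorem measurable_measureReal_section {Ω Y : Type*} [MeasurableSpace Ω] [MeasurableSpace Y]
    (P : Measure Ω) [IsProbabilityMeasure P] {N : Set (Ω × Y)} (hN : MeasurableSet N) :
    Measurable fun y => P.real {z | (z, y) ∈ N} :=
  (measurable_measure_prodMk_right hN).ennreal_toReal

/-- Fubini: both sides are the product measure of `N`. -/
theorem integral_measureReal_section_comm {Ω Y : Type*} [MeasurableSpace Ω] [MeasurableSpace Y]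
    (P : Measure Ω) [IsProbabilityMeasure P] (ν : Measure Y) [IsProbabilityMeasure ν]
    {N : Set (Ω × Y)} (hN : MeasurableSet N) :
    ∫ z, ν.real {y | (z, y) ∈ N} ∂P = ∫ y, P.real {z | (z, y) ∈ N} ∂ν := by
  have e1 := integral_toReal (μ := P) (f := fun z => ν {y | (z, y) ∈ N})
    (measurable_measure_prodMk_left hN).aemeasurable
    (Eventually.of_forall fun _ => measure_lt_top _ _)
  have e2 := integral_toReal (μ := ν) (f := fun y => P {z | (z, y) ∈ N})
    (measurable_measure_prodMk_right hN).aemeasurable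
    (Eventually.of_forall fun _ => measure_lt_top _ _)
  refine e1.trans (Eq.trans ?_ e2.symm)
  exact congrArg _ ((Measure.prod_apply hN).symm.trans (Measure.prod_apply_symm hN))

/-- Convergence of the first two moments of the measures of random sets. -/
theorem tendsto_moments_measureReal_section {Ω Y : Type*} [MeasurableSpace Ω] [MeasurableSpace Y]
    (P : Measure Ω) [IsProbabilityMeasure P] (ν : Measure Y) [IsProbabilityMeasure ν]
    {M : ℕ → Set (Ω × Y)} (hM : ∀ n, MeasurableSet (M n)) {Q : Y → ℝ}
    (hQ : ∀ y, ∀ᶠ n in atTop, P.real {z | (z, y) ∈ M n} = Q y)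
    (hind : ∀ᵐ p ∂ν.prod ν, ∀ᶠ n in atTop, P.real {z | (z, p.1) ∈ M n ∧ (z, p.2) ∈ M n}
      = P.real {z | (z, p.1) ∈ M n} * P.real {z | (z, p.2) ∈ M n}) :
    Tendsto (fun n => ∫ z, ν.real {y | (z, y) ∈ M n} ∂P) atTop (𝓝 (∫ y, Q y ∂ν)) ∧
      Tendsto (fun n => ∫ z, ν.real {y | (z, y) ∈ M n} ^ 2 ∂P) atTop (𝓝 ((∫ y, Q y ∂ν) ^ 2)) := by
  -- The squared measure of a section is the `ν.prod ν`-measure of a section of `M₂ n`. Hence the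
  -- second moment is an integral over pairs of points, to which Fubini applies as for the first
  -- moment.
  let M₂ : ℕ → Set (Ω × (Y × Y)) := fun n => {x | (x.1, x.2.1) ∈ M n ∧ (x.1, x.2.2) ∈ M n}
  have hM₂ : ∀ n, MeasurableSet (M₂ n) := fun n =>
    ((measurable_fst.prodMk measurable_snd.fst) (hM n)).inter
      ((measurable_fst.prodMk measurable_snd.snd) (hM n))
  have hsq : ∀ n z, ν.real {y | (z, y) ∈ M n} ^ 2 = (ν.prod ν).real {p | (z, p) ∈ M₂ n} := by
    intro n z
    have e : {p : Y × Y | (z, p) ∈ M₂ n} = {y | (z, y) ∈ M n} ×ˢ {y | (z, y) ∈ M n} := rfl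
    rw [e, measureReal_prod_prod, sq]
  constructor
  · simp only [integral_measureReal_section_comm P ν (hM _)]
    refine tendsto_integral_of_dominated_convergence (fun _ => 1)
      (fun n => (measurable_measureReal_section P (hM n)).aestronglyMeasurable) (integrable_const _)
      (fun n => Eventually.of_forall fun y => ?_)
      (Eventually.of_forall fun y => tendsto_const_nhds.congr' ((hQ y).mono fun n h => h.symm))
    rw [Real.norm_of_nonneg measureReal_nonneg]
    exact measureReal_le_one
  · simp only [hsq, integral_measureReal_section_comm P (ν.prod ν) (hM₂ _)]
    rw [sq, ← integral_prod_mul]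
    refine tendsto_integral_of_dominated_convergence (fun _ => 1)
      (fun n => (measurable_measureReal_section P (hM₂ n)).aestronglyMeasurable) (integrable_const _)
      (fun n => Eventually.of_forall fun y => ?_) ?_
    · rw [Real.norm_of_nonneg measureReal_nonneg]
      exact measureReal_le_one
    · filter_upwards [hind] with p hp
      refine tendsto_const_nhds.congr' ?_
      filter_upwards [hp, hQ p.1, hQ p.2] with n h h1 h2
      rw [← h1, ← h2, ← h]
      rfl

/-! ### Random labellings -/

/-- On a standard Borel space there are countably valued measurable maps that eventually separate
any two points. -/
theorem exists_measurable_eventually_ne (Y : Type*) [MeasurableSpace Y] [StandardBorelSpace Y] :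
    ∃ π : ℕ → Y → ℤ, (∀ n, Measurable (π n)) ∧
      ∀ x y, x ≠ y → ∀ᶠ n in atTop, π n x ≠ π n y := by
  have he := measurableEmbedding_embeddingReal Y
  -- A copy of the space in ℝ is cut into intervals of length 1/n; two points are separated once n
  -- is at least the inverse of their distance.
  refine ⟨fun n y => ⌊(n : ℝ) * embeddingReal Y y⌋,
    fun n => Int.measurable_floor.comp (he.measurable.const_mul _), fun x y hxy => ?_⟩
  have hpos : 0 < |embeddingReal Y x - embeddingReal Y y| :=
    abs_pos.2 (sub_ne_zero.2 fun h => hxy (he.injective h))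
  obtain ⟨N, hN⟩ := exists_nat_ge (1 / |embeddingReal Y x - embeddingReal Y y|)
  filter_upwards [eventually_ge_atTop N] with n hn h
  have h1 := Int.abs_sub_lt_one_of_floor_eq_floor h
  rw [← mul_sub, abs_mul, Nat.abs_cast] at h1
  rw [div_le_iff₀ hpos] at hN
  have : (N : ℝ) * |embeddingReal Y x - embeddingReal Y y|
      ≤ n * |embeddingReal Y x - embeddingReal Y y| := by gcongr
  linarith

/-- If almost all pairs of points have disjoint finite patterns `(t i y)ᵢ`, there is a labelling of
the space for which the labels on these patterns are distributed almost as independent labels. -/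
theorem exists_labelling {Y Z ι κ : Type*} [MeasurableSpace Y] [StandardBorelSpace Y]
    [MeasurableSpace Z] [Finite ι] [Fintype κ] (ν : Measure Y) [IsProbabilityMeasure ν]
    (η : Measure Z) [IsProbabilityMeasure η] {t : ι → Y → Y} (ht : ∀ i, Measurable (t i))
    (hdisj : ∀ᵐ p ∂ν.prod ν, ∀ i j, t i p.1 ≠ t j p.2)
    {S : κ → Set ((ι → Z) × Y)} (hS : ∀ m, MeasurableSet (S m)) {ε : ℝ} (hε : 0 < ε) :
    ∃ φ : Y → Z, Measurable φ ∧ ∀ m, |ν.real {y | ((fun i => φ (t i y)), y) ∈ S m} -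
      ∫ y, (reindexLaw η fun i => t i y).real {x | (x, y) ∈ S m} ∂ν| < ε := by
  obtain ⟨π, hπ, hsep⟩ := exists_measurable_eventually_ne Y
  -- A point of `ℤ → Z` labels the pieces of the `n`-th cutting; `T n` records the labels that `y`
  -- sees on its pattern.
  let T : ℕ → (ℤ → Z) × Y → (ι → Z) × Y := fun n p => ((fun i => p.1 (π n (t i p.2))), p.2)
  have hT : ∀ n, Measurable (T n) := by
    intro n
    refine (measurable_pi_lambda _ fun i => ?_).prodMk measurable_snd
    have hev : Measurable (fun q : (ℤ → Z) × ℤ => q.1 q.2) :=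
      measurable_from_prod_countable_left fun δ => measurable_pi_apply δ
    exact hev.comp (measurable_fst.prodMk ((hπ n).comp ((ht i).comp measurable_snd)))
  let P : Measure (ℤ → Z) := Measure.infinitePi fun _ => η
  let M : κ → ℕ → Set ((ℤ → Z) × Y) := fun m n => T n ⁻¹' S m
  have hM : ∀ m n, MeasurableSet (M m n) := fun m n => hT n (hS m)
  have hslice : ∀ m y, MeasurableSet {x : ι → Z | (x, y) ∈ S m} := fun m y =>
    measurable_prodMk_right (hS m)
  have hlaw : ∀ m n y, P.real {z | (z, y) ∈ M m n}
      = (reindexLaw η fun i => π n (t i y)).real {x | (x, y) ∈ S m} := fun m n y =>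
    (map_measureReal_apply (measurable_reindex Z fun i => π n (t i y)) (hslice m y)).symm
  -- As the pattern of `y` is finite, `π n` eventually separates all its distinct points. From then
  -- on the law of the labels equals its limit.
  have hQ : ∀ m y, ∀ᶠ n in atTop, P.real {z | (z, y) ∈ M m n}
      = (reindexLaw η fun i => t i y).real {x | (x, y) ∈ S m} := by
    intro m y
    have : ∀ᶠ n in atTop, ∀ i j, t i y ≠ t j y → π n (t i y) ≠ π n (t j y) := by
      simp only [eventually_all]
      exact fun i j h => hsep _ _ h
    filter_upwards [this] with n hn
    rw [hlaw, reindexLaw_congr η fun i j => ⟨fun h => by_contra fun h' => hn i j h' h,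
      fun h => congrArg (π n) h⟩]
  -- Disjoint finite patterns eventually meet disjoint sets of pieces, whose labels are independent.
  have hind : ∀ m, ∀ᵐ p ∂ν.prod ν, ∀ᶠ n in atTop,
      P.real {z | (z, p.1) ∈ M m n ∧ (z, p.2) ∈ M m n}
        = P.real {z | (z, p.1) ∈ M m n} * P.real {z | (z, p.2) ∈ M m n} := by
    intro m
    filter_upwards [hdisj] with p hp
    have : ∀ᶠ n in atTop, ∀ i j, π n (t i p.1) ≠ π n (t j p.2) := by
      simp only [eventually_all]
      exact fun i j => hsep _ _ (hp i j)
    filter_upwards [this] with n hn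
    have h := (indepFun_reindex η hn).measure_inter_preimage_eq_mul _ _ (hslice m p.1)
      (hslice m p.2)
    have h' := congrArg ENNReal.toReal h
    rwa [ENNReal.toReal_mul] at h'
  obtain ⟨n, z, h⟩ := exists_forall_abs_sub_lt_of_tendsto_moments (P := P)
    (fun m n z => ν.real {y | (z, y) ∈ M m n}) _
    (fun m n => MemLp.of_bound
      (measurable_measure_prodMk_left (hM m n)).ennreal_toReal.aestronglyMeasurable 1
      (Eventually.of_forall fun z => by
        rw [Real.norm_of_nonneg measureReal_nonneg]
        exact measureReal_le_one))
    (fun m => (tendsto_moments_measureReal_section P ν (hM m) (hQ m) (hind m)).1)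
    (fun m => (tendsto_moments_measureReal_section P ν (hM m) (hQ m) (hind m)).2) hε
  exact ⟨fun y => z (π n y), (measurable_of_countable z).comp (hπ n), h⟩

/-! ### The measure of the joining -/

/-- The disintegration of the random Bernoulli shift over `f ↦ H_f`. -/
theorem shiftFactor_disintegration_apply {Γ : Type u} [Group Γ] [Countable Γ] {Z : Type w}
    [MeasurableSpace Z] [StandardBorelSpace Z] (θ : IRS Γ) (η : Measure Z)
    [IsProbabilityMeasure η] {A : Set (ShiftSpace Γ Z)} (hA : MeasurableSet A) :
    ∀ᵐ H ∂θ.measure, (shiftFactor θ η).disintegration H A = cosetProductMeasure η H A := by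
  let κ : Kernel (Subgroup Γ) (ShiftSpace Γ Z) := (shiftFactor θ η).disintegration
  refine ae_eq_of_forall_setLIntegral_eq_of_sigmaFinite (μ := θ.measure) (f := fun H => κ H A)
    (Kernel.measurable_coe κ hA)
    ((Measure.measurable_coe hA).comp (measurable_cosetProductMeasure η)) fun C hC _ => ?_
  refine ((shiftFactor θ η).setLIntegral_disintegration hC hA).trans ?_
  have hCA : MeasurableSet (ShiftSpace.proj ⁻¹' C ∩ A) := (ShiftSpace.measurable_proj hC).inter hA
  refine (shiftMeasure_apply θ η hCA).trans ?_
  rw [← lintegral_indicator hC]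
  refine lintegral_congr fun H => ?_
  -- The measure `cosetProductMeasure η H` lives on the fibre over `H`, so intersecting with the
  -- preimage of `C` keeps everything or nothing.
  by_cases h : H ∈ C
  · rw [indicator_of_mem h, cosetProductMeasure, Measure.map_apply (ShiftSpace.measurable_mk H) hCA,
      Measure.map_apply (ShiftSpace.measurable_mk H) hA]
    congr 1
    ext f
    exact ⟨fun hf => hf.2, fun hf => ⟨h, hf⟩⟩
  · rw [indicator_of_notMem h, cosetProductMeasure,
      Measure.map_apply (ShiftSpace.measurable_mk H) hCA]
    refine measure_mono_null (t := ∅) (fun f hf => h hf.1) measure_empty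

/-- The function t ↦ `p.disintegration t B` is the density of the image of `a.μ.restrict B` with
respect to `c.μ`. This moves integrals from the factor up to `a`, so the fibre measures of `a` never
have to be known. -/
theorem FactorMap.lintegral_mul_disintegration {Γ : Type u} [Group Γ] {a : MPAction.{u, v} Γ}
    {c : MPAction.{u, w} Γ} (p : FactorMap a c) {g : c.X → ENNReal} (hg : Measurable g)
    {B : Set a.X} (hB : MeasurableSet B) :
    ∫⁻ t, g t * p.disintegration t B ∂c.μ = ∫⁻ y in B, g (p.toFun y) ∂a.μ := by
  have hd : Measurable fun t => p.disintegration t B := Kernel.measurable_coe p.disintegration hB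
  have h : (a.μ.restrict B).map p.toFun = c.μ.withDensity fun t => p.disintegration t B := by
    ext C hC
    rw [Measure.map_apply p.measurable hC, Measure.restrict_apply (p.measurable hC),
      withDensity_apply _ hC, p.setLIntegral_disintegration hC hB]
  rw [← lintegral_map hg p.measurable, h, lintegral_withDensity_eq_lintegral_mul _ hd hg]
  exact lintegral_congr fun t => mul_comm _ _

/-- The kernel that sends a point `y` to the law of independent labels on the cosets of its
stabilizer. -/
noncomputable def stabilizerShiftKernel {Γ : Type u} [Group Γ] [Countable Γ] {Z : Type w}
    [MeasurableSpace Z] (η : Measure Z) [IsProbabilityMeasure η] (a : MPAction.{u, v} Γ) :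
    Kernel a.X (ShiftSpace Γ Z) where
  toFun y := cosetProductMeasure η (MulAction.stabilizer Γ y)
  measurable' := (measurable_cosetProductMeasure η).comp (measurable_stabilizer a)

theorem stabilizerShiftKernel_apply {Γ : Type u} [Group Γ] [Countable Γ] {Z : Type w}
    [MeasurableSpace Z] (η : Measure Z) [IsProbabilityMeasure η] (a : MPAction.{u, v} Γ) (y : a.X) :
    stabilizerShiftKernel η a y = cosetProductMeasure η (MulAction.stabilizer Γ y) :=
  rfl

instance {Γ : Type u} [Group Γ] [Countable Γ] {Z : Type w}
    [MeasurableSpace Z] (η : Measure Z) [IsProbabilityMeasure η] (a : MPAction.{u, v} Γ) :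
    IsMarkovKernel (stabilizerShiftKernel η a) :=
  ⟨fun y => by rw [stabilizerShiftKernel_apply]; infer_instance⟩

/-- The joining of the random Bernoulli shift with `a` arises by choosing a point of `a` and then
independent labels on the cosets of its stabilizer. -/
theorem relIndepMeasure_shiftFactor_stabilizerFactor {Γ : Type u} [Group Γ] [Countable Γ]
    {Z : Type w} [MeasurableSpace Z] [StandardBorelSpace Z] (η : Measure Z)
    [IsProbabilityMeasure η] {θ : IRS Γ} (a : MPAction.{u, v} Γ) (hθ : a.type = θ) :
    relIndepMeasure (shiftFactor θ η) (stabilizerFactor a hθ)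
      = (a.μ.compProd (stabilizerShiftKernel η a)).map Prod.swap := by
  have : IsProbabilityMeasure ((a.μ.compProd (stabilizerShiftKernel η a)).map Prod.swap) :=
    Measure.isProbabilityMeasure_map measurable_swap.aemeasurable
  refine Measure.ext_prod fun {A B} hA hB => ?_
  have hm : Measurable fun H : Subgroup Γ => cosetProductMeasure η H A :=
    (Measure.measurable_coe hA).comp (measurable_cosetProductMeasure η)
  have hr : ∀ {A : Set (ShiftSpace Γ Z)} (_ : MeasurableSet A),
      ((a.μ.compProd (stabilizerShiftKernel η a)).map Prod.swap) (A ×ˢ B)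
      = ∫⁻ y in B, cosetProductMeasure η (MulAction.stabilizer Γ y) A ∂a.μ := by
    intro A hA
    rw [Measure.map_apply measurable_swap (MeasurableSet.prod hA hB), preimage_swap_prod,
      Measure.compProd_apply_prod hB hA]
    rfl
  -- On a rectangle, the fibre measure of the shift is replaced by the explicit product measure, and
  -- that of `a` is absorbed by integrating over `B`.
  refine (relIndepMeasure_prod _ _ hA hB).trans (Eq.trans (lintegral_congr_ae ?_)
    (((stabilizerFactor a hθ).lintegral_mul_disintegration hm hB).trans (hr hA).symm))
  filter_upwards [shiftFactor_disintegration_apply θ η hA] with H h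
  rw [h]

/-! ### Criteria for weak containment -/

theorem measurePreserving_fst_relIndepMeasure {Γ : Type u} [Group Γ] {a : MPAction.{u, v} Γ}
    {b : MPAction.{u, w} Γ} {c : MPAction.{u, z} Γ} (p : FactorMap a c) (q : FactorMap b c) :
    MeasurePreserving Prod.fst (relIndepMeasure p q) a.μ := by
  refine ⟨measurable_fst, ?_⟩
  ext A hA
  rw [Measure.map_apply measurable_fst hA, ← prod_univ, relIndepMeasure_prod p q hA .univ]
  simp only [measure_univ, mul_one]
  rw [← setLIntegral_univ, p.setLIntegral_disintegration .univ hA, preimage_univ, univ_inter]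

theorem measurePreserving_snd_relIndepMeasure {Γ : Type u} [Group Γ] {a : MPAction.{u, v} Γ}
    {b : MPAction.{u, w} Γ} {c : MPAction.{u, z} Γ} (p : FactorMap a c) (q : FactorMap b c) :
    MeasurePreserving Prod.snd (relIndepMeasure p q) b.μ := by
  refine ⟨measurable_snd, ?_⟩
  ext B hB
  rw [Measure.map_apply measurable_snd hB, ← univ_prod, relIndepMeasure_prod p q .univ hB]
  simp only [measure_univ, one_mul]
  rw [← setLIntegral_univ, q.setLIntegral_disintegration .univ hB, preimage_univ, univ_inter]

theorem image_smul_eq_preimage {Γ X : Type*} [Group Γ] [MulAction Γ X] (γ : Γ) (A : Set X) :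
    (fun x => γ • x) '' A = (fun x => γ⁻¹ • x) ⁻¹' A :=
  congrFun (image_eq_preimage_of_inverse (inv_smul_smul γ) (smul_inv_smul γ)) A

theorem MPAction.measurableSet_image_smul {Γ : Type u} [Group Γ] (a : MPAction.{u, v} Γ) (γ : Γ)
    {A : Set a.X} (hA : MeasurableSet A) : MeasurableSet ((fun x => γ • x) '' A) := by
  rw [image_smul_eq_preimage]
  exact a.measurable_smul γ⁻¹ hA

/-- An equivariant measure preserving image of an action is weakly contained in the action. -/
theorem weaklyContained_of_measurePreserving {Γ : Type u} [Group Γ] {a : MPAction.{u, v} Γ}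
    {b : MPAction.{u, w} Γ} {f : b.X → a.X} (hf : MeasurePreserving f b.μ a.μ)
    (hs : ∀ (γ : Γ) x, f (γ • x) = γ • f x) : WeaklyContained a b := by
  intro k A hA hd hU F ε hε
  refine ⟨fun i => f ⁻¹' A i, fun i => hf.measurable (hA i),
    fun i j hij => (hd hij).preimage f, by rw [← preimage_iUnion, hU, preimage_univ], ?_⟩
  intro γ _ i j
  have e : (fun y => γ • y) '' (f ⁻¹' A i) ∩ f ⁻¹' A j
      = f ⁻¹' ((fun x => γ • x) '' A i ∩ A j) := by
    rw [preimage_inter, image_smul_eq_preimage, image_smul_eq_preimage]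
    ext x
    simp only [mem_inter_iff, mem_preimage, hs]
  have hm : MeasurableSet ((fun x => γ • x) '' A i ∩ A j) :=
    (a.measurableSet_image_smul γ (hA i)).inter (hA j)
  rw [e, hf.measureReal_preimage hm.nullMeasurableSet, sub_self, abs_zero]
  exact hε

theorem WeaklyContained.trans {Γ : Type u} [Group Γ] {a : MPAction.{u, v} Γ}
    {b : MPAction.{u, w} Γ} {c : MPAction.{u, z} Γ} (hab : WeaklyContained a b)
    (hbc : WeaklyContained b c) : WeaklyContained a c := by
  intro k A hA hd hU F ε hε
  obtain ⟨B, hB, hBd, hBU, hAB⟩ := hab k A hA hd hU F (ε / 2) (half_pos hε)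
  obtain ⟨C, hC, hCd, hCU, hBC⟩ := hbc k B hB hBd hBU F (ε / 2) (half_pos hε)
  refine ⟨C, hC, hCd, hCU, fun γ hγ i j => ?_⟩
  have h1 := hAB γ hγ i j
  have h2 := hBC γ hγ i j
  rw [abs_lt] at *
  constructor <;> linarith

open scoped symmDiff in
/-- A finite measurable partition can be approximated by partitions into members of a generating
algebra. -/
theorem exists_partition_mem_setAlgebra {X : Type*} [m : MeasurableSpace X] [Nonempty X]
    (μ : Measure X) [IsFiniteMeasure μ] {𝒜 : Set (Set X)} (h𝒜 : IsSetAlgebra 𝒜)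
    (hgen : m = MeasurableSpace.generateFrom 𝒜) {k : ℕ} {A : Fin k → Set X}
    (hA : ∀ i, MeasurableSet (A i)) (hd : Pairwise fun i j => Disjoint (A i) (A j))
    (hU : ⋃ i, A i = univ) {ε : ℝ} (hε : 0 < ε) :
    ∃ B : Fin k → Set X, (∀ i, B i ∈ 𝒜) ∧ (Pairwise fun i j => Disjoint (B i) (B j)) ∧
      ⋃ i, B i = univ ∧ ∀ i, μ.real (A i ∆ B i) < ε := by
  obtain ⟨x₀⟩ := ‹Nonempty X›
  obtain ⟨i₀, -⟩ := mem_iUnion.1 (hU.symm ▸ mem_univ x₀ : x₀ ∈ ⋃ i, A i)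
  -- A nonempty space needs at least one piece, so there is a last index to absorb whatever the
  -- approximations miss.
  obtain ⟨n, rfl⟩ : ∃ n, k = n + 1 := Nat.exists_eq_succ_of_ne_zero (Nat.ne_zero_of_lt i₀.2)
  have hdense := Measure.MeasureDense.of_generateFrom_isSetAlgebra_finite (μ := μ) h𝒜 hgen
  have hδ : 0 < ε / (n + 1) := by positivity
  choose T hT hAT using fun i => hdense.approx (A i) (hA i) (measure_ne_top _ _) _ hδ
  have hAT' : ∀ i, μ.real (A i ∆ T i) < ε / (n + 1) := fun i =>
    (ENNReal.lt_ofReal_iff_toReal_lt (measure_ne_top _ _)).1 (hAT i)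
  -- With the whole space in last place, the successive differences of the `U i` cover everything.
  let U : Fin (n + 1) → Set X := fun i => if i = Fin.last n then univ else T i
  have hUm : ∀ i, U i ∈ 𝒜 := by
    intro i
    by_cases h : i = Fin.last n
    · simp only [U, if_pos h]; exact h𝒜.univ_mem
    · simp only [U, if_neg h]; exact hT i
  refine ⟨disjointed U, fun i => disjointedRec (fun s j hs => h𝒜.sdiff_mem hs (hUm j)) (hUm i),
    disjoint_disjointed U, ?_, fun i => ?_⟩
  · rw [iUnion_disjointed]
    exact eq_univ_of_forall fun x => mem_iUnion.2 ⟨Fin.last n, by simp [U]⟩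
  -- A point outside all the errors lies in `T l` for exactly one `l`, that of its piece `A l`, and
  -- the successive differences put it in the same piece. All n + 1 errors may count against each
  -- `i`, whence the tolerance ε / (n + 1).
  have hsub : A i ∆ disjointed U i ⊆ ⋃ j, A j ∆ T j := by
    intro x hx
    by_contra hn
    have hiff : ∀ j, x ∈ A j ↔ x ∈ T j := by
      intro j
      have : x ∉ A j ∆ T j := fun h => hn (mem_iUnion.2 ⟨j, h⟩)
      rw [mem_symmDiff] at this
      tauto
    obtain ⟨l, hl⟩ := mem_iUnion.1 (hU.symm ▸ mem_univ x : x ∈ ⋃ i, A i)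
    have huniq : ∀ j, x ∈ A j ↔ j = l := fun j =>
      ⟨fun h => by_contra fun hjl => (hd hjl).le_bot ⟨h, hl⟩, fun h => h ▸ hl⟩
    have hmemU : ∀ j, x ∈ U j ↔ j = Fin.last n ∨ j = l := by
      intro j
      by_cases h : j = Fin.last n
      · simp [U, h]
      · simp [U, h, ← hiff, huniq]
    have : x ∈ disjointed U i ↔ x ∈ A i := by
      rw [disjointed_eq_inter_compl, huniq]
      simp only [mem_inter_iff, mem_iInter, mem_compl_iff, hmemU]
      constructor
      · rintro ⟨h | h, h'⟩
        · by_contra hil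
          exact h' l (lt_of_le_of_ne (h ▸ Fin.le_last l) (Ne.symm hil)) (Or.inr rfl)
        · exact h
      · rintro rfl
        refine ⟨Or.inr rfl, fun j hj => ?_⟩
        rintro (h | h)
        · exact absurd (Fin.le_last i) (not_le.2 (h ▸ hj))
        · exact hj.ne h
    rw [mem_symmDiff] at hx
    tauto
  calc μ.real (A i ∆ disjointed U i) ≤ μ.real (⋃ j, A j ∆ T j) := measureReal_mono hsub
    _ ≤ ∑ j, μ.real (A j ∆ T j) := measureReal_iUnion_fintype_le _
    _ < ∑ _j : Fin (n + 1), ε / (n + 1) :=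
      Finset.sum_lt_sum_of_nonempty Finset.univ_nonempty fun j _ => hAT' j
    _ = ε := by
      rw [Finset.sum_const, Finset.card_univ, Fintype.card_fin, nsmul_eq_mul]
      push_cast
      field_simp

open scoped symmDiff in
/-- Weak containment follows from the existence of equivariant maps that are almost measure
preserving on finitely many members of an invariant generating algebra. -/
theorem weaklyContained_of_setAlgebra {Γ : Type u} [Group Γ] {a : MPAction.{u, v} Γ}
    {b : MPAction.{u, w} Γ} {𝒜 : Set (Set a.X)} (h𝒜 : IsSetAlgebra 𝒜)
    (hgen : a.meas = MeasurableSpace.generateFrom 𝒜)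
    (hinv : ∀ (γ : Γ), ∀ A ∈ 𝒜, (fun x => γ • x) '' A ∈ 𝒜)
    (happrox : ∀ (ι : Type u) [Fintype ι] (C : ι → Set a.X), (∀ m, C m ∈ 𝒜) → ∀ ε : ℝ, 0 < ε →
      ∃ f : b.X → a.X, Measurable f ∧ (∀ (γ : Γ) x, f (γ • x) = γ • f x) ∧
        ∀ m, |a.μ.real (C m) - b.μ.real (f ⁻¹' C m)| < ε) : WeaklyContained a b := by
  intro k A hA hd hU F ε hε
  have hmeas : ∀ A ∈ 𝒜, MeasurableSet A := fun A hA =>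
    hgen ▸ MeasurableSpace.measurableSet_generateFrom hA
  obtain ⟨A', hA', hd', hU', hAA'⟩ := exists_partition_mem_setAlgebra a.μ h𝒜 hgen hA hd hU
    (show 0 < ε / 3 by positivity)
  -- The events to be matched are all γA'ᵢ ∩ A'ⱼ. One third of ε goes to `f`, the other two to
  -- replacing `A i` and `A j` by members of the algebra.
  obtain ⟨f, hf, hfs, hfC⟩ := happrox (F × Fin k × Fin k)
    (fun m => (fun x => (m.1 : Γ) • x) '' A' m.2.1 ∩ A' m.2.2)
    (fun m => h𝒜.inter_mem (hinv _ _ (hA' _)) (hA' _)) (ε / 3) (by positivity)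
  refine ⟨fun i => f ⁻¹' A' i, fun i => hf (hmeas _ (hA' i)), fun i j hij => (hd' hij).preimage f,
    by rw [← preimage_iUnion, hU', preimage_univ], fun γ hγ i j => ?_⟩
  have e : (fun y => γ • y) '' (f ⁻¹' A' i) ∩ f ⁻¹' A' j
      = f ⁻¹' ((fun x => γ • x) '' A' i ∩ A' j) := by
    rw [preimage_inter, image_smul_eq_preimage, image_smul_eq_preimage]
    ext x
    simp only [mem_inter_iff, mem_preimage, hfs]
  have h1 := hfC (⟨γ, hγ⟩, i, j)
  have hsub : ((fun x => γ • x) '' A i ∩ A j) ∆ ((fun x => γ • x) '' A' i ∩ A' j)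
      ⊆ (fun x => γ⁻¹ • x) ⁻¹' (A i ∆ A' i) ∪ A j ∆ A' j := by
    rw [image_smul_eq_preimage, image_smul_eq_preimage]
    intro x
    simp only [mem_symmDiff, mem_inter_iff, mem_union, mem_preimage]
    tauto
  have hm : MeasurableSet (A i ∆ A' i) := (hA i).symmDiff (hmeas _ (hA' i))
  have h2 : |a.μ.real ((fun x => γ • x) '' A i ∩ A j)
      - a.μ.real ((fun x => γ • x) '' A' i ∩ A' j)| < ε / 3 + ε / 3 :=
    calc _ ≤ a.μ.real (((fun x => γ • x) '' A i ∩ A j) ∆ ((fun x => γ • x) '' A' i ∩ A' j)) :=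
          abs_measureReal_sub_le_measureReal_symmDiff
            ((a.measurableSet_image_smul γ (hA i)).inter (hA j)).nullMeasurableSet
            ((a.measurableSet_image_smul γ (hmeas _ (hA' i))).inter
              (hmeas _ (hA' j))).nullMeasurableSet
      _ ≤ a.μ.real ((fun x => γ⁻¹ • x) ⁻¹' (A i ∆ A' i)) + a.μ.real (A j ∆ A' j) :=
          (measureReal_mono hsub).trans (measureReal_union_le _ _)
      _ < _ := by
          rw [(a.measurePreserving γ⁻¹).measureReal_preimage hm.nullMeasurableSet]
          exact add_lt_add (hAA' i) (hAA' j)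
  rw [e]
  rw [abs_lt] at *
  constructor <;> linarith

/-! ### Events depending on finitely many labels, and configurations read off from a labelling -/

section Labelled

variable {Γ : Type u} [Group Γ] {Z : Type w} {Y : Type v}

/-- The labels on a finite set of cosets, together with the subgroup and the second coordinate. -/
def coordMap (F : Finset Γ) (x : ShiftSpace Γ Z × Y) : (F → Z) × Subgroup Γ × Y :=
  (fun γ => x.1.toFun (rightCoset x.1.subgroup γ), x.1.subgroup, x.2)

/-- The configuration on the cosets of the stabilizer of a point that is read off from a labelling
of the space. -/
def labelMap [MulAction Γ Y] (φ : Y → Z) (y : Y) : ShiftSpace Γ Z × Y :=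
  (⟨MulAction.stabilizer Γ y, Quotient.lift (fun γ : Γ => φ (γ⁻¹ • y)) fun γ δ h => by
    -- Because of the inverse, γ⁻¹y depends only on the right coset of γ: if δγ⁻¹ fixes y, then γ⁻¹y
    -- = δ⁻¹y.
    have h' : δ * γ⁻¹ ∈ MulAction.stabilizer Γ y := QuotientGroup.rightRel_apply.1 h
    rw [MulAction.mem_stabilizer_iff, mul_smul] at h'
    change φ (γ⁻¹ • y) = φ (δ⁻¹ • y)
    rw [eq_inv_smul_iff.2 h']⟩, y)

variable [MeasurableSpace Z] [MeasurableSpace Y]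

theorem measurable_label (γ : Γ) :
    Measurable fun f : ShiftSpace Γ Z => f.toFun (rightCoset f.subgroup γ) :=
  (measurable_pi_apply γ).comp (measurable_fst.comp (comap_measurable ShiftSpace.embed))

/-- The σ-algebra on the source is left free, so that the criterion serves both the full σ-algebra
and those of finitely many coordinates. -/
theorem measurable_coordMap_comp {α : Type*} {mα : MeasurableSpace α} {F : Finset Γ}
    {g : α → ShiftSpace Γ Z × Y}
    (h₁ : ∀ γ ∈ F, Measurable fun x => (g x).1.toFun (rightCoset (g x).1.subgroup γ))
    (h₂ : Measurable fun x => ((g x).1.subgroup, (g x).2)) :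
    Measurable fun x => coordMap F (g x) :=
  (measurable_pi_lambda (fun x (γ : F) => (g x).1.toFun (rightCoset (g x).1.subgroup γ))
    fun γ => h₁ γ γ.2).prodMk h₂

theorem measurable_coordMap (F : Finset Γ) :
    Measurable (coordMap F : ShiftSpace Γ Z × Y → (F → Z) × Subgroup Γ × Y) :=
  measurable_coordMap_comp (g := fun x => x) (fun γ _ => (measurable_label γ).comp measurable_fst)
    ((ShiftSpace.measurable_proj.comp measurable_fst).prodMk measurable_snd)

variable (Z Y) in
/-- The σ-algebra of events that depend on the labels of only finitely many given cosets. -/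
abbrev finiteCoordSpace (F : Finset Γ) : MeasurableSpace (ShiftSpace Γ Z × Y) :=
  MeasurableSpace.comap (coordMap F) inferInstance

theorem measurable_finiteCoordSpace_label {F : Finset Γ} {γ : Γ} (hγ : γ ∈ F) :
    Measurable[finiteCoordSpace Z Y F]
      fun x : ShiftSpace Γ Z × Y => x.1.toFun (rightCoset x.1.subgroup γ) :=
  (measurable_pi_apply (⟨γ, hγ⟩ : F)).comp (measurable_fst.comp (comap_measurable (coordMap F)))

theorem measurable_finiteCoordSpace_snd (F : Finset Γ) :
    Measurable[finiteCoordSpace Z Y F]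
      fun x : ShiftSpace Γ Z × Y => (x.1.subgroup, x.2) :=
  measurable_snd.comp (comap_measurable (coordMap F))

theorem finiteCoordSpace_mono {F G : Finset Γ} (h : F ⊆ G) :
    finiteCoordSpace Z Y F ≤ finiteCoordSpace Z Y G := by
  refine measurable_iff_comap_le.1 ?_
  exact measurable_coordMap_comp (mα := finiteCoordSpace Z Y G) (g := fun x => x)
    (fun γ hγ => measurable_finiteCoordSpace_label (h hγ)) (measurable_finiteCoordSpace_snd G)

variable (Γ Z Y) in
/-- The algebra of events that depend on the labels of only finitely many cosets. -/
def finiteCoordSets : Set (Set (ShiftSpace Γ Z × Y)) :=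
  {A | ∃ F : Finset Γ, MeasurableSet[finiteCoordSpace Z Y F] A}

theorem isSetAlgebra_finiteCoordSets : IsSetAlgebra (finiteCoordSets Γ Z Y) := by
  classical
  refine ⟨⟨∅, @MeasurableSet.empty _ (finiteCoordSpace Z Y ∅)⟩, fun A ⟨F, h⟩ => ⟨F, ?_⟩,
    fun A B ⟨F, hA⟩ ⟨G, hB⟩ => ⟨F ∪ G, ?_⟩⟩
  · exact @MeasurableSet.compl _ _ (finiteCoordSpace Z Y F) h
  · exact @MeasurableSet.union _ (finiteCoordSpace Z Y (F ∪ G)) _ _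
      (finiteCoordSpace_mono Finset.subset_union_left _ hA)
      (finiteCoordSpace_mono Finset.subset_union_right _ hB)

/-- The Borel structure of `ShiftSpace` is induced by the subgroup and the individual labels, and
each of these is measurable for some finite set of coordinates. -/
theorem generateFrom_finiteCoordSets :
    (inferInstance : MeasurableSpace (ShiftSpace Γ Z × Y))
      = MeasurableSpace.generateFrom (finiteCoordSets Γ Z Y) := by
  refine le_antisymm ?_ (MeasurableSpace.generateFrom_le fun A ⟨F, hA⟩ =>
    measurable_iff_comap_le.1 (measurable_coordMap F) _ hA)
  have hle : ∀ F : Finset Γ, finiteCoordSpace Z Y F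
      ≤ MeasurableSpace.generateFrom (finiteCoordSets Γ Z Y) := fun F A hA =>
    MeasurableSpace.measurableSet_generateFrom ⟨F, hA⟩
  have hsnd :=
    (measurable_finiteCoordSpace_snd (Z := Z) (Y := Y) (∅ : Finset Γ)).mono (hle ∅) le_rfl
  have hY : Measurable[MeasurableSpace.generateFrom (finiteCoordSets Γ Z Y)]
      fun x : ShiftSpace Γ Z × Y => x.2 := hsnd.snd
  have hH : Measurable[MeasurableSpace.generateFrom (finiteCoordSets Γ Z Y)]
      fun x : ShiftSpace Γ Z × Y => x.1.subgroup := hsnd.fst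
  have hZ : Measurable[MeasurableSpace.generateFrom (finiteCoordSets Γ Z Y)]
      fun (x : ShiftSpace Γ Z × Y) γ => x.1.toFun (rightCoset x.1.subgroup γ) :=
    @measurable_pi_lambda _ _ _ (_) _ _ fun γ =>
      (measurable_finiteCoordSpace_label (Finset.mem_singleton_self γ)).mono (hle {γ}) le_rfl
  have hS : Measurable[MeasurableSpace.generateFrom (finiteCoordSets Γ Z Y)]
      fun x : ShiftSpace Γ Z × Y => x.1 :=
    measurable_comap_iff.2 (hZ.prodMk hH)
  exact sup_le (measurable_iff_comap_le.1 hS) (measurable_iff_comap_le.1 hY)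

/-- The label of γ⁻¹ • x at δ is the label of x at γδ, so translating by γ replaces the coordinates
`F` by γF. -/
theorem image_smul_mem_finiteCoordSets [MulAction Γ Y]
    (hY : ∀ γ : Γ, Measurable fun y : Y => γ • y) (γ : Γ) {A : Set (ShiftSpace Γ Z × Y)}
    (hA : A ∈ finiteCoordSets Γ Z Y) : (fun x => γ • x) '' A ∈ finiteCoordSets Γ Z Y := by
  classical
  obtain ⟨F, hA⟩ := hA
  rw [image_smul_eq_preimage]
  refine ⟨F.image fun δ => γ * δ, ?_⟩
  refine @Measurable.comp _ _ _ (finiteCoordSpace Z Y _) _ _ _ _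
    (@measurable_id _ _) ?_ _ hA
  refine measurable_comap_iff.2 ?_
  refine measurable_coordMap_comp (mα := finiteCoordSpace Z Y _) (g := fun x => γ⁻¹ • x)
    (fun δ hδ => ?_) (((measurable_conj γ⁻¹).prodMap (hY γ⁻¹)).comp
      (measurable_finiteCoordSpace_snd (Z := Z) (Y := Y) (F.image fun δ => γ * δ)))
  have h := measurable_finiteCoordSpace_label (Z := Z) (Y := Y)
    (Finset.mem_image_of_mem (fun δ => γ * δ) hδ)
  have e : (fun x : ShiftSpace Γ Z × Y =>
        (γ⁻¹ • x).1.toFun (rightCoset (γ⁻¹ • x).1.subgroup δ))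
      = fun x => x.1.toFun (rightCoset x.1.subgroup (γ * δ)) := by
    funext x
    have := congrFun (congrArg Prod.fst (ShiftSpace.embed_smul γ⁻¹ x.1)) δ
    rw [inv_inv] at this
    exact this
  rw [← e] at h
  exact h

end Labelled

/-! ### The joining is weakly contained in the action -/

theorem labelMap_smul {Γ : Type u} [Group Γ] {Z : Type w} (a : MPAction.{u, v} Γ) (φ : a.X → Z)
    (γ : Γ) (y : a.X) : labelMap φ (γ • y) = γ • (labelMap φ y : ShiftSpace Γ Z × a.X) := by
  refine Prod.ext (ShiftSpace.embed_injective ?_) rfl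
  change ShiftSpace.embed _ = ShiftSpace.embed (γ • (labelMap φ y : ShiftSpace Γ Z × a.X).1)
  rw [ShiftSpace.embed_smul]
  refine Prod.ext (funext fun δ => ?_) (stabilizer_smul_eq a γ y)
  change φ (δ⁻¹ • γ • y) = φ ((γ⁻¹ * δ)⁻¹ • y)
  rw [mul_inv_rev, inv_inv, mul_smul]

theorem measurable_labelMap {Γ : Type u} [Group Γ] {Z : Type w} [MeasurableSpace Z]
    (a : MPAction.{u, v} Γ) {φ : a.X → Z} (hφ : Measurable φ) :
    Measurable (labelMap φ : a.X → ShiftSpace Γ Z × a.X) := by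
  refine Measurable.prodMk (measurable_comap_iff.2 ?_) measurable_id
  exact (measurable_pi_lambda _ fun γ => hφ.comp (a.measurable_smul γ⁻¹)).prodMk
    (measurable_stabilizer a)

/-- For given γ, δ and x, the only bad y is δ⁻¹γx, a null set; Fubini and the countability of Γ do
the rest. Non-atomicity enters the theorem only here. -/
theorem MPAction.NonAtomic.ae_smul_ne_smul {Γ : Type u} [Group Γ] [Countable Γ]
    {a : MPAction.{u, v} Γ} (ha : a.NonAtomic) :
    ∀ᵐ p ∂a.μ.prod a.μ, ∀ γ δ : Γ, γ • p.1 ≠ δ • p.2 := by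
  simp only [ae_all_iff]
  intro γ δ
  have hm : MeasurableSet {p : a.X × a.X | γ • p.1 = δ • p.2} :=
    measurableSet_eq_fun ((a.measurable_smul γ).comp measurable_fst)
      ((a.measurable_smul δ).comp measurable_snd)
  have h0 : a.μ.prod a.μ {p : a.X × a.X | γ • p.1 = δ • p.2} = 0 := by
    rw [Measure.measure_prod_null hm]
    refine Eventually.of_forall fun x => ?_
    refine measure_mono_null (t := {δ⁻¹ • γ • x}) (fun y hy => ?_) (ha _)
    exact eq_inv_smul_iff.2 (Eq.symm hy)
  filter_upwards [measure_eq_zero_iff_ae_notMem.1 h0] with p hp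
  exact hp

/-- The measure of an event that depends on finitely many labels. -/
theorem relIndepMeasure_real_preimage_coordMap {Γ : Type u} [Group Γ] [Countable Γ]
    {Z : Type w} [MeasurableSpace Z] [StandardBorelSpace Z] (η : Measure Z)
    [IsProbabilityMeasure η] {θ : IRS Γ} (a : MPAction.{u, v} Γ) (hθ : a.type = θ)
    {F : Finset Γ} {S : Set ((F → Z) × Subgroup Γ × a.X)} (hS : MeasurableSet S) :
    (relIndepMeasure (shiftFactor θ η) (stabilizerFactor a hθ)).real (coordMap F ⁻¹' S)
      = ∫ y, (reindexLaw η fun γ : F => (γ : Γ)⁻¹ • y).real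
          {x | (x, MulAction.stabilizer Γ y, y) ∈ S} ∂a.μ := by
  have hC : MeasurableSet (coordMap F ⁻¹' S : Set (ShiftSpace Γ Z × a.X)) :=
    measurable_coordMap F hS
  have hslice : ∀ (H : Subgroup Γ) (y : a.X), MeasurableSet {x : F → Z | (x, H, y) ∈ S} :=
    fun H y => measurable_prodMk_right hS
  have hslice' : ∀ y : a.X, MeasurableSet
      {f | ((f, y) : ShiftSpace Γ Z × a.X) ∈ coordMap F ⁻¹' S} :=
    fun y => measurable_prodMk_right hC
  have h1 : relIndepMeasure (shiftFactor θ η) (stabilizerFactor a hθ) (coordMap F ⁻¹' S)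
      = ∫⁻ y, stabilizerShiftKernel η a y
        {f | ((f, y) : ShiftSpace Γ Z × a.X) ∈ coordMap F ⁻¹' S} ∂a.μ := by
    rw [relIndepMeasure_shiftFactor_stabilizerFactor]
    refine (Measure.map_apply measurable_swap hC).trans ?_
    rw [Measure.compProd_apply (measurable_swap hC)]
    rfl
  have h2 : ∀ y, stabilizerShiftKernel η a y
        {f | ((f, y) : ShiftSpace Γ Z × a.X) ∈ coordMap F ⁻¹' S}
      = (reindexLaw η fun γ : F => (γ : Γ)⁻¹ • y) {x | (x, MulAction.stabilizer Γ y, y) ∈ S} := by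
    intro y
    -- The points γ⁻¹y coincide exactly when the cosets of the stabilizer do, so independent labels
    -- on points of the orbit and on cosets have the same joint law.
    have hc : ∀ γ δ : F, (γ : Γ)⁻¹ • y = (δ : Γ)⁻¹ • y ↔
        rightCoset (MulAction.stabilizer Γ y) γ = rightCoset (MulAction.stabilizer Γ y) δ := by
      intro γ δ
      rw [rightCoset_eq, MulAction.mem_stabilizer_iff, mul_smul, eq_inv_smul_iff]
    rw [reindexLaw_congr η hc, reindexLaw, stabilizerShiftKernel_apply, cosetProductMeasure,
      Measure.map_apply (measurable_reindex Z _) (hslice _ _),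
      Measure.map_apply (ShiftSpace.measurable_mk _) (hslice' y)]
    rfl
  have hm : Measurable fun y => stabilizerShiftKernel η a y
      {f | ((f, y) : ShiftSpace Γ Z × a.X) ∈ coordMap F ⁻¹' S} :=
    Kernel.measurable_kernel_prodMk_left (measurable_swap hC)
  have h3 := integral_toReal (μ := a.μ) hm.aemeasurable
    (Eventually.of_forall fun _ => measure_lt_top _ _)
  rw [Measure.real, h1, ← h3]
  exact integral_congr_ae (Eventually.of_forall fun y => congrArg ENNReal.toReal (h2 y))

/-- A non-atomic action weakly contains its joining with the random Bernoulli shift. -/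
theorem weaklyContained_relIndepJoining {Γ : Type u} [Group Γ] [Countable Γ]
    {Z : Type w} [MeasurableSpace Z] [StandardBorelSpace Z] (η : Measure Z)
    [IsProbabilityMeasure η] {θ : IRS Γ} (a : MPAction.{u, v} Γ) (ha : a.NonAtomic)
    (hθ : a.type = θ) :
    WeaklyContained (relIndepJoining (shiftFactor θ η) (stabilizerFactor a hθ)) a := by
  classical
  refine weaklyContained_of_setAlgebra (𝒜 := finiteCoordSets Γ Z a.X)
    isSetAlgebra_finiteCoordSets generateFrom_finiteCoordSets
    (fun γ A hA => image_smul_mem_finiteCoordSets a.measurable_smul γ hA) ?_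
  intro κ _ C hC ε hε
  choose G hG using hC
  -- Finitely many events share one finite set of coordinates.
  let F : Finset Γ := Finset.univ.biUnion G
  have hF : ∀ m, MeasurableSet[finiteCoordSpace Z a.X F] (C m) := fun m =>
    finiteCoordSpace_mono (Finset.subset_biUnion_of_mem G (Finset.mem_univ m)) _ (hG m)
  choose S hS hSC using hF
  -- Along `labelMap` the subgroup is the stabilizer of the second coordinate, so each event becomes
  -- a condition on the labels and the point alone, as `exists_labelling` requires.
  have hS' : ∀ m, MeasurableSet
      {p : (F → Z) × a.X | (p.1, MulAction.stabilizer Γ p.2, p.2) ∈ S m} := fun m =>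
    (measurable_fst.prodMk (((measurable_stabilizer a).comp measurable_snd).prodMk
      measurable_snd)) (hS m)
  obtain ⟨φ, hφ, h⟩ := exists_labelling a.μ η (t := fun (γ : F) y => (γ : Γ)⁻¹ • y)
    (fun γ => a.measurable_smul _)
    (ha.ae_smul_ne_smul.mono fun p hp i j => hp _ _) hS' hε
  refine ⟨labelMap φ, measurable_labelMap a hφ, labelMap_smul a φ, fun m => ?_⟩
  have hJ := relIndepMeasure_real_preimage_coordMap η a hθ (hS m)
  rw [abs_sub_comm, ← hSC m]
  refine lt_of_eq_of_lt (congrArg (fun r => |_ - r|) hJ) (h m)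

end MPA

open MPA MeasureTheory
theorem theorem1p5 {Γ : Type*} [Group Γ] [Countable Γ]
    {Z : Type*} [MeasurableSpace Z] [StandardBorelSpace Z] (η : Measure Z) [IsProbabilityMeasure η]
    (θ : IRS Γ) (a : MPAction Γ) (ha : a.NonAtomic) (hθ : a.type = θ) :
    WeaklyEquivalent (relIndepJoining (shiftFactor θ η) (stabilizerFactor a hθ)) a ∧
      WeaklyContained (randomBernoulliShift θ η) a := by
  have h := weaklyContained_relIndepJoining η a ha hθ
  refine ⟨⟨h, weaklyContained_of_measurePreserving
    (measurePreserving_snd_relIndepMeasure _ _) fun _ _ => rfl⟩, WeaklyContained.trans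
    (weaklyContained_of_measurePreserving (measurePreserving_fst_relIndepMeasure _ _)
      fun _ _ => rfl) h⟩
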